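/- Let $k\ge 2$ be an even integer, let $c_1,\dots,c_k$ be positive integers, and put $h=c_1+\cdots+c_k$, $N=2\cdot\mathrm{lcm}(c_1,\dots,c_k)$ and $D=(-1)^{k/2}\,4\,c_1c_2\cdots c_k$. For $\tau$ in the upper half-plane let $q^{r}=e^{2\pi i r\tau}$ ($r\in\mathbb{Q}$), and let $$\Psi(\tau)=\sum_{n=0}^{\infty}q^{n(n+1)/2}$$ be the generating function of the triangular numbers. Then the function $$q^{h/8}\prod_{i=1}^{k}\Psi(c_i\tau)$$ is a (holomorphic) modular form of weight $k/2$ on $\Gamma_0(N)$ with character $\chi=\left(\frac{D}{\cdot}\right)$ if and only if $h\equiv 0\pmod 8$. Here $\left(\frac{D}{\cdot}\right)$ is the Kronecker symbol, and the left-hand side means: $d\mapsto\left(\frac{D}{d}\right)$ is a Dirichlet character $\chi$ modulo $N$, and the function lies in the space $M_{k/2}(\Gamma_0(N),\chi)$, i.e. it is a modular form $f$ of weight $k/2$ on $\Gamma_1(N)$ that satisfies $f\!\left(\frac{\alpha\tau+\beta}{\gamma\tau+\delta}\right)=\chi(\delta)\,(\gamma\tau+\delta)^{k/2}f(\tau)$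 for all $\begin{pmatrix}\alpha&\beta\\ \gamma&\delta\end{pmatrix}\in\Gamma_0(N)$. -/

import Mathlib

open scoped MatrixGroups ModularForm

/-- The generating function `Ψ(τ) = ∑_{n ≥ 0} q ^ (n(n+1)/2)`, `q = exp(2πiτ)`, of the
triangular numbers (a convergent series when `τ` lies in the upper half plane). -/
noncomputable def triangularPsi (τ : ℂ) : ℂ :=
  ∑' n : ℕ, Complex.exp (2 * Real.pi * Complex.I * τ) ^ (n * (n + 1) / 2)

/-- The product `Ψ_C(τ) = ∏ i, Ψ(c_i τ)` for a tuple of coefficients `c`. -/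
noncomputable def triangularPsiProd {k : ℕ} (c : Fin k → ℕ) (τ : ℂ) : ℂ :=
  ∏ i, triangularPsi ((c i : ℂ) * τ)

/-- The Kronecker symbol `(a / n)` for integers `a` and `n`: for `n = u * 2 ^ e * m` with `u = ±1`
and `m` odd and positive it is `(a / u) * (a / 2) ^ e * J(a | m)`, where `(a / 1) = 1`,
`(a / -1) = -1` exactly if `a < 0`, and `(a / 2)` is `0` for even `a`, `1` for `a ≡ ±1 mod 8`,
`-1` for `a ≡ ±3 mod 8`; moreover `(a / 0)` is `1` if `a = ±1` and `0` otherwise. -/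
def kroneckerSym (a n : ℤ) : ℤ :=
  if n = 0 then (if a.natAbs = 1 then 1 else 0)
  else (if n < 0 ∧ a < 0 then -1 else 1)
    * ZMod.χ₈ (a : ZMod 8) ^ padicValNat 2 n.natAbs
    * jacobiSym a (n.natAbs / 2 ^ padicValNat 2 n.natAbs)

/-- The space `M_k(Γ₀(N), χ)` of (holomorphic) modular forms of weight `k` on `Γ₀(N)` with
character `χ`, a Dirichlet character modulo `N`: the modular forms `f` of weight `k` on `Γ₁(N)`
with `f ∣[k] γ = χ(d) f` for every `γ = (a, b; c, d)` in `Γ₀(N)`. -/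
noncomputable def modularFormsWithChar (N : ℕ) (k : ℤ) (χ : DirichletCharacter ℂ N) :
    Submodule ℂ (ModularForm ((CongruenceSubgroup.Gamma1 N).map
      (Matrix.SpecialLinearGroup.mapGL ℝ)) k) where
  carrier := {f | ∀ γ : SL(2, ℤ), γ ∈ CongruenceSubgroup.Gamma0 N →
    (⇑f : UpperHalfPlane → ℂ) ∣[k] γ = χ ((γ 1 1 : ℤ) : ZMod N) • (⇑f : UpperHalfPlane → ℂ)}
  zero_mem' := by
    intro γ _
    simp
  add_mem' := by
    intro f g hf hg γ hγ
    simp only [FunLike.coe_add, SlashAction.add_slash, hf γ hγ, hg γ hγ, smul_add]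
  smul_mem' := by
    intro a f hf γ hγ
    have h1 : (⇑(a • f) : UpperHalfPlane → ℂ) = a • (⇑f : UpperHalfPlane → ℂ) := rfl
    rw [h1, ModularForm.SL_smul_slash, hf γ hγ, smul_comm]

/-! Since `(n + 1/2)² = n(n+1) + 1/4`, one has `q^{1/8} Ψ(τ) = θ₂(τ)/2`, so the function is `2^{-k}
∏ θ₂(c_i τ)`. Translation by 1 multiplies it by `exp(2πi h/8)`. It does not vanish at `i`, where
every `Ψ(c_i · i)` is a sum of positive terms. As the translation lies in `Γ₀(N)` with `χ(1) = 1`,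
modularity forces `8 ∣ h`.

Conversely, let `8 ∣ h`. Poisson summation and a quadratic Gauss sum `G` give the law of `θ` under
matrices with lower right entry an odd prime `p` (`jacobiTheta_moebius_prime`). It passes to `θ₂`
through `θ₂(τ) = θ(τ/4) - θ(τ)`. In a product of an even number of such factors the square roots
disappear: `G² = (-1/p) p` leaves the Legendre symbol of `(-1)^{k/2} ∏ c_i`
(`thetaTwoProd_slash_prime`). Dirichlet's theorem on primes, with translations on both sides,
reduces all of `Γ₀(N)` to such matrices. Quadratic reciprocity and `8 ∣ h` show that the Kronecker
symbol is a character modulo `N`.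

Growth at the cusps needs no expansions there: `thetaSize`, built from the three theta constants, is
`SL(2, ℤ)`-invariant, so it is controlled on the fundamental domain. -/

open Complex
open UpperHalfPlane hiding I

/-! ### Theta constants: inversion, translation and growth -/

section Theta

/-- The theta constant `θ₂(τ) = ∑ₙ exp(πi (n + 1/2)² τ)`. -/
noncomputable def thetaTwo (τ : ℂ) : ℂ :=
  cexp (Real.pi * I * τ / 4) * jacobiTheta₂ (τ / 2) τ

/-- The theta constant `θ₄(τ) = ∑ₙ (-1)ⁿ exp(πi n² τ)`. -/
noncomputable def thetaFour (τ : ℂ) : ℂ := jacobiTheta₂ (1 / 2) τ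

/-- The terms at `n` and `-(n + 1)` of the theta series coincide, so the sum over `ℤ` is twice the
sum over `ℕ`. -/
theorem thetaTwo_eq_triangularPsi {τ : ℂ} (hτ : 0 < τ.im) :
    thetaTwo τ = 2 * (cexp (Real.pi * I * τ / 4) * triangularPsi τ) := by
  have key : ∀ n : ℕ, cexp (2 * Real.pi * I * τ) ^ (n * (n + 1) / 2) =
      cexp (Real.pi * I * (n * (n + 1)) * τ) := by
    intro n
    rw [← Complex.exp_nat_mul]
    congr 1
    obtain ⟨m, hm⟩ := even_iff_two_dvd.mp (Nat.even_mul_succ_self n)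
    have h2 : ((n : ℂ) * (n + 1)) = 2 * m := by exact_mod_cast congrArg (Nat.cast (R := ℂ)) hm
    rw [show n * (n + 1) = 2 * m from hm, Nat.mul_div_cancel_left _ two_pos, h2]
    ring
  have hs := hasSum_jacobiTheta₂_term (τ / 2) hτ
  have h1 : ∀ n : ℕ, jacobiTheta₂_term n (τ / 2) τ = cexp (Real.pi * I * (n * (n + 1)) * τ) := by
    intro n
    rw [jacobiTheta₂_term]
    push_cast
    ring_nf
  have h2 : ∀ n : ℕ, jacobiTheta₂_term (-(n + 1 : ℤ)) (τ / 2) τ =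
      cexp (Real.pi * I * (n * (n + 1)) * τ) := by
    intro n
    rw [jacobiTheta₂_term]
    push_cast
    ring_nf
  have hsum : Summable fun n : ℕ ↦ cexp (Real.pi * I * (n * (n + 1)) * τ) := by
    simpa only [← h1, Function.comp_def] using
      hs.summable.comp_injective (i := fun n : ℕ ↦ (n : ℤ)) Nat.cast_injective
  have h3 : HasSum (fun n : ℕ ↦ cexp (Real.pi * I * (n * (n + 1)) * τ)) (triangularPsi τ) := by
    rw [triangularPsi]
    simp only [key]
    exact hsum.hasSum
  have h4 := HasSum.of_nat_of_neg_add_one (f := fun n : ℤ ↦ jacobiTheta₂_term n (τ / 2) τ)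
    (by simpa only [h1] using h3) (by simpa only [h2] using h3)
  rw [thetaTwo, hs.unique h4]
  ring

theorem exp_pi_mul_I_mul_even {n : ℤ} (hn : Even n) : cexp (Real.pi * I * n) = 1 := by
  obtain ⟨m, rfl⟩ := hn
  rw [Complex.exp_eq_one_iff]
  exact ⟨m, by push_cast; ring⟩

/-- The two shifts together multiply the `n`-th term by `exp(πi n(n + 1))`, and `n(n + 1)` is even.
-/
theorem jacobiTheta₂_add_half_add_one (z τ : ℂ) :
    jacobiTheta₂ (z + 1 / 2) (τ + 1) = jacobiTheta₂ z τ := by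
  refine tsum_congr fun n ↦ ?_
  rw [jacobiTheta₂_term, jacobiTheta₂_term]
  have h : cexp (Real.pi * I * ((n * (n + 1) : ℤ))) = 1 :=
    exp_pi_mul_I_mul_even (Int.even_mul_succ_self n)
  rw [show 2 * Real.pi * I * n * (z + 1 / 2) + Real.pi * I * n ^ 2 * (τ + 1) =
    (2 * Real.pi * I * n * z + Real.pi * I * n ^ 2 * τ) + Real.pi * I * ((n * (n + 1) : ℤ)) by
      push_cast; ring, Complex.exp_add, h, mul_one]

theorem thetaTwo_add_one (τ : ℂ) :
    thetaTwo (τ + 1) = cexp (Real.pi * I / 4) * thetaTwo τ := by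
  rw [thetaTwo, thetaTwo, ← jacobiTheta₂_add_half_add_one (τ / 2) τ, ← mul_assoc, ← Complex.exp_add]
  ring_nf

theorem thetaFour_add_one (τ : ℂ) : thetaFour (τ + 1) = jacobiTheta τ := by
  rw [thetaFour, jacobiTheta_eq_jacobiTheta₂, ← jacobiTheta₂_add_half_add_one 0, zero_add]

theorem jacobiTheta_add_one (τ : ℂ) : jacobiTheta (τ + 1) = thetaFour τ := by
  have h := jacobiTheta₂_add_half_add_one (1 / 2) τ
  have h' := jacobiTheta₂_add_left 0 (τ + 1)
  rw [add_halves] at h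
  rw [zero_add] at h'
  rw [thetaFour, jacobiTheta_eq_jacobiTheta₂, ← h, h']

theorem neg_I_mul_cpow_half_ne_zero {τ : ℂ} (hτ : τ ≠ 0) : (-I * τ) ^ (1 / 2 : ℂ) ≠ 0 := by
  simp [Complex.cpow_eq_zero_iff, hτ]

theorem norm_neg_I_mul_cpow_half (τ : ℂ) : ‖(-I * τ) ^ (1 / 2 : ℂ)‖ = ‖τ‖ ^ (1 / 2 : ℝ) := by
  have := Complex.norm_cpow_real (-I * τ) (1 / 2)
  push_cast at this
  rw [this]
  simp

theorem jacobiTheta_neg_inv {τ : ℂ} (hτ : τ ≠ 0) :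
    jacobiTheta (-1 / τ) = (-I * τ) ^ (1 / 2 : ℂ) * jacobiTheta τ := by
  have h := jacobiTheta₂_functional_equation 0 τ
  have h1 := neg_I_mul_cpow_half_ne_zero hτ
  rw [jacobiTheta_eq_jacobiTheta₂, jacobiTheta_eq_jacobiTheta₂, h]
  simp only [zero_div, ne_eq, OfNat.ofNat_ne_zero, not_false_eq_true, zero_pow, mul_zero,
    Complex.exp_zero]
  field_simp

theorem thetaFour_neg_inv {τ : ℂ} (hτ : τ ≠ 0) :
    thetaFour (-1 / τ) = (-I * τ) ^ (1 / 2 : ℂ) * thetaTwo τ := by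
  have h := jacobiTheta₂_functional_equation (τ / 2) τ
  have h1 := neg_I_mul_cpow_half_ne_zero hτ
  rw [thetaTwo, thetaFour, h, show τ / 2 / τ = 1 / 2 by field_simp]
  have h2 : cexp (Real.pi * I * τ / 4) * cexp (-Real.pi * I * (τ / 2) ^ 2 / τ) = 1 := by
    rw [← Complex.exp_add, Complex.exp_eq_one_iff]
    exact ⟨0, by field_simp; ring⟩
  calc _ = ((-I * τ) ^ (1 / 2 : ℂ) * (1 / (-I * τ) ^ (1 / 2 : ℂ))) *
      (cexp (Real.pi * I * τ / 4) * cexp (-Real.pi * I * (τ / 2) ^ 2 / τ)) *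
        jacobiTheta₂ (1 / 2) (-1 / τ) := by rw [h2, mul_one_div_cancel h1]; ring
    _ = _ := by ring

theorem tsum_eq_sum_residues {f : ℤ → ℂ} (hf : Summable f) (p : ℕ) [NeZero p] :
    ∑' n, f n = ∑ r : Fin p, ∑' m : ℤ, f (m * p + r) := by
  have hf' : Summable fun x : ℤ × Fin p ↦ f (x.1 * p + x.2) :=
    (Int.divModEquiv p).symm.summable_iff.mpr hf
  rw [← (Int.divModEquiv p).symm.tsum_eq f, ← tsum_fintype (L := .unconditional _)]
  exact ((Equiv.prodComm _ _).tsum_eq _).symm.trans hf'.prod_symm.tsum_prod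

/-- Even indices give `θ`, odd ones `θ₂`. This reduces both the growth and the transformation of
`θ₂` to those of `θ`. -/
theorem jacobiTheta_div_four {τ : ℂ} (hτ : 0 < τ.im) :
    jacobiTheta (τ / 4) = jacobiTheta τ + thetaTwo τ := by
  have h4 : 0 < (τ / 4).im := by
    rw [show τ / 4 = ((1 / 4 : ℝ) : ℂ) * τ by push_cast; ring, Complex.im_ofReal_mul]
    positivity
  rw [jacobiTheta_eq_jacobiTheta₂, jacobiTheta_eq_jacobiTheta₂, thetaTwo, jacobiTheta₂,
    tsum_eq_sum_residues (hasSum_jacobiTheta₂_term 0 h4).summable 2, Fin.sum_univ_two,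
    jacobiTheta₂, jacobiTheta₂, ← tsum_mul_left]
  congr 1
  · refine tsum_congr fun n ↦ ?_
    rw [jacobiTheta₂_term, jacobiTheta₂_term]
    simp only [Fin.val_zero, Int.cast_add, Int.cast_mul, Int.cast_natCast]
    push_cast
    ring_nf
  · refine tsum_congr fun n ↦ ?_
    rw [jacobiTheta₂_term, jacobiTheta₂_term, ← Complex.exp_add]
    simp only [Fin.val_one, Int.cast_add, Int.cast_mul, Int.cast_natCast]
    push_cast
    ring_nf

/-- The `SL(2, ℤ)`-invariant size of the triple of theta constants. -/
noncomputable def thetaSize (τ : ℍ) : ℝ :=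
  τ.im ^ (1 / 4 : ℝ) * (‖thetaTwo τ‖ + ‖jacobiTheta τ‖ + ‖thetaFour τ‖)

theorem thetaSize_T_smul (τ : ℍ) : thetaSize (ModularGroup.T • τ) = thetaSize τ := by
  have h : ((ModularGroup.T • τ : ℍ) : ℂ) = τ + 1 := by
    rw [modular_T_smul, coe_vadd]
    push_cast
    ring
  have h' : (ModularGroup.T • τ : ℍ).im = τ.im := by
    rw [← coe_im, h]
    simp
  have h1 : ‖cexp (Real.pi * I / 4)‖ = 1 := by
    rw [show Real.pi * I / 4 = ((Real.pi / 4 : ℝ) : ℂ) * I by push_cast; ring,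
      Complex.norm_exp_ofReal_mul_I]
  rw [thetaSize, thetaSize, h, h', thetaTwo_add_one, jacobiTheta_add_one, thetaFour_add_one,
    norm_mul, h1]
  ring

theorem thetaSize_S_smul (τ : ℍ) : thetaSize (ModularGroup.S • τ) = thetaSize τ := by
  have h : ((ModularGroup.S • τ : ℍ) : ℂ) = -1 / τ := by
    rw [modular_S_smul]
    simp [neg_div]
  have h0 := τ.ne_zero
  have h0' : (-1 / τ : ℂ) ≠ 0 := by simp [h0]
  have hn : 0 < ‖(τ : ℂ)‖ := norm_pos_iff.mpr h0
  have h' : (ModularGroup.S • τ : ℍ).im = τ.im / ‖(τ : ℂ)‖ ^ 2 := by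
    rw [← coe_im, h, ← Complex.normSq_eq_norm_sq]
    simp [neg_div]
  have h3 : ‖jacobiTheta (-1 / τ)‖ = ‖(τ : ℂ)‖ ^ (1 / 2 : ℝ) * ‖jacobiTheta τ‖ := by
    rw [jacobiTheta_neg_inv h0, norm_mul, norm_neg_I_mul_cpow_half]
  have h4 : ‖thetaFour (-1 / τ)‖ = ‖(τ : ℂ)‖ ^ (1 / 2 : ℝ) * ‖thetaTwo τ‖ := by
    rw [thetaFour_neg_inv h0, norm_mul, norm_neg_I_mul_cpow_half]
  have h2 : ‖thetaTwo (-1 / τ)‖ = ‖(τ : ℂ)‖ ^ (1 / 2 : ℝ) * ‖thetaFour τ‖ := by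
    -- The inversion law is used at `-1/τ`, which swaps the roles of `θ₂` and `θ₄`.
    have := congrArg norm (thetaFour_neg_inv h0')
    rw [norm_mul, norm_neg_I_mul_cpow_half, show (-1 / (-1 / τ) : ℂ) = τ by field_simp] at this
    rw [this, norm_div, norm_neg, norm_one, Real.div_rpow zero_le_one hn.le, Real.one_rpow]
    field_simp
  have h5 : (τ.im / ‖(τ : ℂ)‖ ^ 2) ^ (1 / 4 : ℝ) * ‖(τ : ℂ)‖ ^ (1 / 2 : ℝ) =
      τ.im ^ (1 / 4 : ℝ) := by
    rw [Real.div_rpow τ.im_pos.le (by positivity), ← Real.rpow_natCast, ← Real.rpow_mul hn.le]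
    norm_num
    field_simp
  rw [thetaSize, thetaSize, h, h', h2, h3, h4, ← h5]
  ring

/-- The generators permute the three theta constants up to phases and the weight `1/2` factor, which
the exponent `1/4` of the imaginary part absorbs. -/
theorem thetaSize_smul (γ : SL(2, ℤ)) (τ : ℍ) : thetaSize (γ • τ) = thetaSize τ := by
  have : γ ∈ Subgroup.closure {ModularGroup.S, ModularGroup.T} := by
    simp [SpecialLinearGroup.SL2Z_generators]
  induction this using Subgroup.closure_induction generalizing τ with
  | one => rw [one_smul]
  | mem g hg =>
    rcases hg with rfl | rfl
    · exact thetaSize_S_smul τ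
    · exact thetaSize_T_smul τ
  | mul g h _ _ ig ih => rw [mul_smul, ig, ih]
  | inv g _ ig => rw [← ig, smul_inv_smul]

theorem exists_norm_jacobiTheta_le {ε : ℝ} (hε : 0 < ε) :
    ∃ C : ℝ, ∀ τ : ℂ, ε ≤ τ.im → ‖jacobiTheta τ‖ ≤ C := by
  refine ⟨2 / (1 - Real.exp (-Real.pi * ε)) + 1, fun τ hτ ↦ ?_⟩
  have h := norm_jacobiTheta_sub_one_le (hε.trans_le hτ)
  have h1 : Real.exp (-Real.pi * ε) < 1 := by
    rw [Real.exp_lt_one_iff]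
    nlinarith [Real.pi_pos]
  have h2 : Real.exp (-Real.pi * τ.im) ≤ Real.exp (-Real.pi * ε) := by
    rw [Real.exp_le_exp]
    nlinarith [Real.pi_pos]
  have h3 : 2 / (1 - Real.exp (-Real.pi * τ.im)) * Real.exp (-Real.pi * τ.im) ≤
      2 / (1 - Real.exp (-Real.pi * ε)) * 1 := by
    have : 0 < 1 - Real.exp (-Real.pi * ε) := by linarith
    gcongr
    exact h2.trans h1.le
  have h4 := norm_sub_norm_le (jacobiTheta τ) 1
  rw [norm_one] at h4
  linarith

theorem exists_thetaSize_le :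
    ∃ C : ℝ, 0 ≤ C ∧ ∀ τ : ℍ, 1 / 2 ≤ τ.im → thetaSize τ ≤ C * τ.im ^ (1 / 4 : ℝ) := by
  -- `τ / 4` has imaginary part at least `1/8`. With `θ₂ = θ(τ/4) - θ(τ)` bounded by `2C`, the three
  -- norms add up to `4C`.
  obtain ⟨C, hC⟩ := exists_norm_jacobiTheta_le (ε := 1 / 8) (by norm_num)
  refine ⟨4 * C, ?_, fun τ hτ ↦ ?_⟩
  · have := (norm_nonneg _).trans (hC Complex.I (by norm_num))
    linarith
  have h1 := hC τ (by rw [coe_im]; linarith)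
  have h2 := hC (τ / 4) (by
    rw [show (τ : ℂ) / 4 = ((1 / 4 : ℝ) : ℂ) * τ by push_cast; ring, Complex.im_ofReal_mul, coe_im]
    linarith)
  have h3 := hC (τ + 1) (by simp; linarith)
  have h4 : ‖thetaTwo τ‖ ≤ ‖jacobiTheta (τ / 4)‖ + ‖jacobiTheta τ‖ := by
    rw [show thetaTwo τ = jacobiTheta (τ / 4) - jacobiTheta τ by
      rw [jacobiTheta_div_four τ.im_pos]; ring]
    exact norm_sub_le _ _
  rw [jacobiTheta_add_one] at h3
  rw [thetaSize, mul_comm]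
  gcongr
  linarith

/-- By invariance, `τ` may be moved into the fundamental domain, where the imaginary part exceeds
`1/2` and is still at most `B`. -/
theorem exists_thetaSize_le_of_im_le :
    ∃ C : ℝ, 0 ≤ C ∧ ∀ (τ : ℍ) (B : ℝ), (∀ γ : SL(2, ℤ), (γ • τ).im ≤ B) →
      thetaSize τ ≤ C * B ^ (1 / 4 : ℝ) := by
  obtain ⟨C, hC0, hC⟩ := exists_thetaSize_le
  refine ⟨C, hC0, fun τ B hB ↦ ?_⟩
  obtain ⟨γ, hγ⟩ := ModularGroup.exists_smul_mem_fd τ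
  have h := ModularGroup.three_le_four_mul_im_sq_of_mem_fd hγ
  have h0 := (γ • τ).im_pos
  rw [← thetaSize_smul γ]
  refine (hC _ (by nlinarith)).trans ?_
  gcongr
  exact hB γ

theorem differentiableAt_thetaTwo {τ : ℂ} (hτ : 0 < τ.im) : DifferentiableAt ℂ thetaTwo τ := by
  unfold thetaTwo
  have h := (hasFDerivAt_jacobiTheta₂ (τ / 2) hτ).differentiableAt.comp τ
    (f := fun t : ℂ ↦ (t / 2, t)) (by fun_prop)
  exact DifferentiableAt.mul (by fun_prop) h

end Theta

/-! ### Quadratic Gauss sums modulo an odd prime -/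

section GaussSum

variable (p : ℕ) [Fact p.Prime]

/-- The quadratic Gauss sum `∑ r, exp(2πi r² / p)`. -/
noncomputable def quadGaussSum : ℂ := ∑ r : ZMod p, ZMod.stdAddChar (r ^ 2)

/-- Each `t` has `χ(t) + 1` square roots; the constant `1` contributes a full character sum, which
is zero. -/
theorem sum_stdAddChar_mul_sq (hp : p ≠ 2) {b : ZMod p} (hb : b ≠ 0) :
    ∑ r : ZMod p, ZMod.stdAddChar (b * r ^ 2) =
      quadraticChar (ZMod p) b *
        gaussSum ((quadraticChar (ZMod p)).ringHomComp (Int.castRingHom ℂ)) ZMod.stdAddChar := by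
  have hF : ringChar (ZMod p) ≠ 2 := by rwa [ZMod.ringChar_zmod_n]
  set χ := (quadraticChar (ZMod p)).ringHomComp (Int.castRingHom ℂ) with hχ
  have h1 : ∑ r : ZMod p, (ZMod.stdAddChar (b * r ^ 2) : ℂ) =
      ∑ t : ZMod p, (χ t + 1) * ZMod.stdAddChar (b * t) := by
    rw [← Finset.sum_fiberwise (s := Finset.univ) (g := fun r : ZMod p ↦ r ^ 2)]
    refine Finset.sum_congr rfl fun t _ ↦ ?_
    have hc := quadraticChar_card_sqrts hF t
    rw [Finset.sum_congr rfl (g := fun _ ↦ (ZMod.stdAddChar (b * t) : ℂ))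
      (fun r hr ↦ by rw [(Finset.mem_filter.mp hr).2]), Finset.sum_const, nsmul_eq_mul]
    congr 1
    rw [hχ, MulChar.ringHomComp_apply, eq_intCast]
    have : ((Finset.univ.filter fun r : ZMod p ↦ r ^ 2 = t).card : ℤ) =
        quadraticChar (ZMod p) t + 1 := by
      rw [← hc]
      congr 2
      ext r
      simp
    exact_mod_cast congrArg (Int.cast (R := ℂ)) this
  have h2 : ∑ t : ZMod p, (ZMod.stdAddChar (b * t) : ℂ) = 0 :=
    AddChar.sum_eq_zero_of_ne_one (ZMod.isPrimitive_stdAddChar p hb)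
  have h3 := gaussSum_mulShift χ ZMod.stdAddChar (Units.mk0 b hb)
  have h4 : χ b * χ b = 1 := by
    rw [hχ, MulChar.ringHomComp_apply, ← map_mul, ← sq, quadraticChar_sq_one hb, map_one]
  rw [h1]
  simp only [add_mul, one_mul, Finset.sum_add_distrib, h2, add_zero]
  rw [gaussSum, Units.val_mk0] at h3
  simp only [AddChar.mulShift_apply] at h3
  rw [← h3, ← mul_assoc]
  have h5 : ((quadraticChar (ZMod p) b : ℤ) : ℂ) = χ b := rfl
  rw [h5, h4, one_mul]

theorem quadGaussSum_eq_gaussSum (hp : p ≠ 2) :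
    quadGaussSum p =
      gaussSum ((quadraticChar (ZMod p)).ringHomComp (Int.castRingHom ℂ)) ZMod.stdAddChar := by
  have h := sum_stdAddChar_mul_sq p hp (one_ne_zero)
  simpa [quadGaussSum] using h

theorem sum_stdAddChar_int_mul_sq (hp : p ≠ 2) {b : ℤ} (hb : (b : ZMod p) ≠ 0) :
    ∑ r : ZMod p, ZMod.stdAddChar (b * r ^ 2 : ZMod p) = legendreSym p b * quadGaussSum p := by
  rw [sum_stdAddChar_mul_sq p hp hb, quadGaussSum_eq_gaussSum p hp]
  rfl

theorem quadGaussSum_sq (hp : p ≠ 2) : quadGaussSum p ^ 2 = legendreSym p (-1) * p := by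
  have hF : ringChar (ZMod p) ≠ 2 := by rwa [ZMod.ringChar_zmod_n]
  have hinj : Function.Injective (Int.castRingHom ℂ) := Int.cast_injective
  rw [quadGaussSum_eq_gaussSum p hp, gaussSum_sq
    ((MulChar.ringHomComp_ne_one_iff hinj).mpr (quadraticChar_ne_one hF))
    ((quadraticChar_isQuadratic _).comp _) (ZMod.isPrimitive_stdAddChar p), ZMod.card]
  simp [legendreSym]

theorem sum_stdAddChar_complete_square (hp : p ≠ 2) {b c : ℤ}
    (hbc : (4 * b * c : ZMod p) = -1) (m : ℤ) :
    ∑ r : ZMod p, ZMod.stdAddChar (b * r ^ 2 + m * r : ZMod p) =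
      ZMod.stdAddChar (c * m ^ 2 : ZMod p) * (legendreSym p b * quadGaussSum p) := by
  have hb : (b : ZMod p) ≠ 0 := by
    intro h
    rw [h] at hbc
    simp at hbc
  rw [← sum_stdAddChar_int_mul_sq p hp hb, Finset.mul_sum,
    -- As `4bc = -1`, the shift `r ↦ r + 2cm` removes the linear term and leaves `br² + cm²`.
    ← Equiv.sum_comp (Equiv.addRight (2 * c * m : ZMod p))]
  refine Finset.sum_congr rfl fun r _ ↦ ?_
  rw [← AddChar.map_add_eq_mul]
  congr 1
  simp only [Equiv.coe_addRight]
  linear_combination (m * r + c * m ^ 2) * hbc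

end GaussSum

/-! ### Transformation of theta under matrices with prime lower right entry -/

section Transformation

/-- In the right half plane arguments lie in `(-π/2, π/2)`, so their difference stays in the
principal branch. -/
theorem cpow_half_div_cpow_half {z w : ℂ} (hz : 0 < z.re) (hw : 0 < w.re) :
    z ^ (1 / 2 : ℂ) / w ^ (1 / 2 : ℂ) = (z / w) ^ (1 / 2 : ℂ) := by
  have hz0 : z ≠ 0 := by rintro rfl; simp at hz
  have hw0 : w ≠ 0 := by rintro rfl; simp at hw
  have h1 := abs_lt.mp (Complex.abs_arg_lt_pi_div_two_iff.mpr (Or.inl hz))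
  have h2 := abs_lt.mp (Complex.abs_arg_lt_pi_div_two_iff.mpr (Or.inl hw))
  have hpi : w.arg ≠ Real.pi := by linarith [Real.pi_pos]
  have harg : w⁻¹.arg = -w.arg := by rw [Complex.arg_inv, if_neg hpi]
  have hlog : Complex.log (z * w⁻¹) = Complex.log z + Complex.log w⁻¹ := by
    refine Complex.log_mul hz0 (inv_ne_zero hw0) ?_
    rw [harg]
    constructor <;> linarith
  rw [div_eq_mul_inv z w, div_eq_mul_inv, ← Complex.inv_cpow _ _ hpi, Complex.cpow_def_of_ne_zero hz0,
    Complex.cpow_def_of_ne_zero (inv_ne_zero hw0), ← Complex.exp_add, ← add_mul, ← hlog,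
    Complex.cpow_def_of_ne_zero (mul_ne_zero hz0 (inv_ne_zero hw0))]

theorem sum_fin_intCast_eq_sum_zmod {p : ℕ} [NeZero p] (F : ZMod p → ℂ) :
    ∑ r : Fin p, F (((r : ℕ) : ℤ) : ZMod p) = ∑ r : ZMod p, F r := by
  rw [← Equiv.sum_comp (ZMod.finEquiv p).toEquiv F]
  refine Finset.sum_congr rfl fun r _ ↦ ?_
  congr 1
  obtain ⟨n, rfl⟩ := Nat.exists_eq_succ_of_ne_zero (NeZero.ne p)
  simp [ZMod.finEquiv]
  exact Fin.cast_val_eq_self r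

theorem im_pos_of_neg_inv {z : ℂ} (hz : 0 < z.im) : 0 < (-1 / z).im := by
  have : 0 < Complex.normSq z := Complex.normSq_pos.mpr (by rintro rfl; simp at hz)
  rw [neg_div, one_div, Complex.neg_im, Complex.inv_im]
  rw [neg_div, neg_neg]
  positivity

/-- A theta series twisted by a quadratic exponential, as a finite sum of values of the two-variable
theta function. -/
theorem jacobiTheta_add_div_eq_sum (p : ℕ) [NeZero p] (b : ℤ) {w : ℂ} (hw : 0 < w.im) :
    jacobiTheta (2 * b / p + w) = 1 / (-I * (p ^ 2 * w)) ^ (1 / 2 : ℂ) *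
      ∑ r : Fin p, ZMod.stdAddChar ((b * (r : ℤ) ^ 2 : ℤ) : ZMod p) *
        jacobiTheta₂ (r / p) (-1 / (p ^ 2 * w)) := by
  have hp : (p : ℂ) ≠ 0 := Nat.cast_ne_zero.mpr (NeZero.ne p)
  have hw0 : w ≠ 0 := by rintro rfl; simp at hw
  have him : 0 < (2 * b / p + w : ℂ).im := by
    have : (2 * b / p : ℂ) = ((2 * b / p : ℝ) : ℂ) := by push_cast; ring
    rw [Complex.add_im, this, Complex.ofReal_im, zero_add]
    exact hw
  rw [jacobiTheta_eq_jacobiTheta₂, jacobiTheta₂,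
    tsum_eq_sum_residues (hasSum_jacobiTheta₂_term 0 him).summable p, Finset.mul_sum]
  refine Finset.sum_congr rfl fun r _ ↦ ?_
  have hterm : ∀ m : ℤ, jacobiTheta₂_term (m * p + r) 0 (2 * b / p + w) =
      ZMod.stdAddChar ((b * (r : ℤ) ^ 2 : ℤ) : ZMod p) * cexp (Real.pi * I * r ^ 2 * w) *
        jacobiTheta₂_term m (r * p * w) (p ^ 2 * w) := by
    intro m
    rw [ZMod.stdAddChar_coe, jacobiTheta₂_term, jacobiTheta₂_term, ← Complex.exp_add,
      ← Complex.exp_add, Complex.exp_eq_exp_iff_exists_int]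
    -- This integer is `(b(mp + r)² - br²)/p`: the quadratic phase depends on `r` only.
    refine ⟨b * (m ^ 2 * p + 2 * m * r), ?_⟩
    push_cast
    field_simp
    ring
  simp only [hterm]
  rw [tsum_mul_left, ← jacobiTheta₂, jacobiTheta₂_functional_equation (r * p * w),
    show (r * p * w / (p ^ 2 * w) : ℂ) = r / p by field_simp]
  have hexp : cexp (Real.pi * I * r ^ 2 * w) *
      cexp (-Real.pi * I * (r * p * w) ^ 2 / (p ^ 2 * w)) = 1 := by
    rw [← Complex.exp_add, Complex.exp_eq_one_iff]
    exact ⟨0, by field_simp; ring⟩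
  linear_combination (ZMod.stdAddChar ((b * (r : ℤ) ^ 2 : ℤ) : ZMod p) *
    (1 / (-I * (p ^ 2 * w)) ^ (1 / 2 : ℂ)) * jacobiTheta₂ (r / p) (-1 / (p ^ 2 * w))) * hexp

/-- For a fixed frequency `m` the sum over `r` is a Gauss sum. Completing the square produces the
phase `exp(2πi cm²/p)`, which cancels the effect of the shift of `τ` by `-2c/p`. -/
theorem sum_stdAddChar_mul_jacobiTheta₂ (p : ℕ) [Fact p.Prime] (hp : p ≠ 2) {b c : ℤ}
    (hbc : (4 * b * c : ZMod p) = -1) {τ : ℂ} (hτ : 0 < τ.im) :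
    ∑ r : Fin p, ZMod.stdAddChar ((b * (r : ℤ) ^ 2 : ℤ) : ZMod p) *
        jacobiTheta₂ (r / p) (-(2 * c) / p + τ) =
      legendreSym p b * quadGaussSum p * jacobiTheta τ := by
  have hp0 : (p : ℂ) ≠ 0 := Nat.cast_ne_zero.mpr (NeZero.ne p)
  have him : 0 < (-(2 * c) / p + τ : ℂ).im := by
    have : (-(2 * c) / p : ℂ) = ((-(2 * c) / p : ℝ) : ℂ) := by push_cast; ring
    rw [Complex.add_im, this, Complex.ofReal_im, zero_add]
    exact hτ
  have hterm : ∀ (r : Fin p) (m : ℤ), ZMod.stdAddChar ((b * (r : ℤ) ^ 2 : ℤ) : ZMod p) *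
      jacobiTheta₂_term m (r / p) (-(2 * c) / p + τ) =
      ZMod.stdAddChar (b * (((r : ℕ) : ℤ) : ZMod p) ^ 2 + m * (((r : ℕ) : ℤ) : ZMod p) : ZMod p) *
        (ZMod.stdAddChar (-(c * m ^ 2) : ZMod p) * jacobiTheta₂_term m 0 τ) := by
    intro r m
    have h1 : (b * (((r : ℕ) : ℤ) : ZMod p) ^ 2 + m * (((r : ℕ) : ℤ) : ZMod p) : ZMod p) =
      ((b * (r : ℤ) ^ 2 + m * r : ℤ) : ZMod p) := by push_cast; rfl
    have h2 : (-(c * m ^ 2) : ZMod p) = ((-(c * m ^ 2) : ℤ) : ZMod p) := by push_cast; rfl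
    rw [h1, h2, ZMod.stdAddChar_coe, ZMod.stdAddChar_coe, ZMod.stdAddChar_coe, jacobiTheta₂_term,
      jacobiTheta₂_term, ← Complex.exp_add, ← Complex.exp_add, ← Complex.exp_add]
    congr 1
    push_cast
    field_simp
    ring
  have hsum : ∀ r : Fin p, Summable fun m : ℤ ↦
      ZMod.stdAddChar ((b * (r : ℤ) ^ 2 : ℤ) : ZMod p) *
      jacobiTheta₂_term m (r / p) (-(2 * c) / p + τ) := fun r ↦
    (hasSum_jacobiTheta₂_term _ him).summable.mul_left _
  simp only [jacobiTheta₂, ← tsum_mul_left]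
  rw [← Summable.tsum_finsetSum fun r _ ↦ hsum r, jacobiTheta_eq_jacobiTheta₂, jacobiTheta₂,
    ← tsum_mul_left]
  refine tsum_congr fun m ↦ ?_
  simp only [hterm]
  rw [← Finset.sum_mul, sum_fin_intCast_eq_sum_zmod
    (fun x : ZMod p ↦ (ZMod.stdAddChar (b * x ^ 2 + m * x : ZMod p) : ℂ)), sum_stdAddChar_complete_square p hp hbc]
  have h : (ZMod.stdAddChar (c * m ^ 2 : ZMod p) : ℂ) * ZMod.stdAddChar (-(c * m ^ 2) : ZMod p) = 1 := by
    rw [← AddChar.map_add_eq_mul, add_neg_cancel, AddChar.map_zero_eq_one]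
  linear_combination (legendreSym p b * quadGaussSum p * jacobiTheta₂_term m 0 τ) * h

/-- The transformation law of `jacobiTheta` under `(a, 2b; 2c, p)` with `p` an odd prime. -/
theorem jacobiTheta_moebius_prime (p : ℕ) [Fact p.Prime] (hp : p ≠ 2) {a b c : ℤ}
    (hdet : a * p - 2 * b * (2 * c) = 1) {τ : ℂ} (hτ : 0 < τ.im) :
    jacobiTheta ((a * τ + 2 * b) / (2 * c * τ + p)) =
      legendreSym p b * quadGaussSum p * ((2 * c * τ + p) / p) ^ (1 / 2 : ℂ) * jacobiTheta τ := by
  have hp0 : (p : ℂ) ≠ 0 := Nat.cast_ne_zero.mpr (NeZero.ne p)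
  have hτ0 : τ ≠ 0 := by rintro rfl; simp at hτ
  have hden : (2 * c * τ + p : ℂ) ≠ 0 := by
    intro h
    have him := congrArg Complex.im h
    have hre := congrArg Complex.re h
    have hc : (c : ℝ) = 0 := by
      simpa [hτ.ne'] using him
    rw [show (c : ℂ) = 0 by exact_mod_cast hc] at h
    simp [hp0] at h
  have hbc : (4 * b * c : ZMod p) = -1 := by
    have := congrArg (Int.cast (R := ZMod p)) hdet
    push_cast at this
    rw [CharP.cast_eq_zero, mul_zero] at this
    linear_combination -this
  have hdet' : (a * p - 2 * b * (2 * c) : ℂ) = 1 := by exact_mod_cast hdet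
  -- The Möbius image is `2b/p + W/p²`, and `-1/W = -2c/p - 1/τ`. Hence one inversion before and one
  -- after the finite sum over residues give the law.
  set W : ℂ := p * τ / (2 * c * τ + p) with hW
  have hW0 : W ≠ 0 := div_ne_zero (mul_ne_zero hp0 hτ0) hden
  have hinv : -1 / W = -(2 * c) / p + -1 / τ := by
    rw [hW]
    field_simp
    ring
  have hWim : 0 < W.im := by
    have h := im_pos_of_neg_inv hτ
    have h' : 0 < (-1 / W).im := by
      have : (-(2 * c) / p : ℂ) = ((-(2 * c) / p : ℝ) : ℂ) := by push_cast; ring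
      rw [hinv, Complex.add_im, this, Complex.ofReal_im, zero_add]
      exact h
    have h'' := im_pos_of_neg_inv h'
    rwa [show -1 / (-1 / W) = W by field_simp] at h''
  have hw : 0 < (W / p ^ 2).im := by
    rw [show W / p ^ 2 = ((1 / p ^ 2 : ℝ) : ℂ) * W by push_cast; ring, Complex.im_ofReal_mul]
    have : (0 : ℝ) < p := Nat.cast_pos.mpr (Fact.out : p.Prime).pos
    positivity
  have harg : (a * τ + 2 * b) / (2 * c * τ + p) = 2 * b / p + W / p ^ 2 := by
    have h1 : W / p ^ 2 * (2 * c * τ + p) = τ / p := by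
      rw [div_mul_eq_mul_div, hW, div_mul_cancel₀ _ hden]
      field_simp
    rw [div_eq_iff hden, add_mul, h1]
    field_simp
    linear_combination τ * hdet'
  rw [harg, jacobiTheta_add_div_eq_sum p b hw, show (p : ℂ) ^ 2 * (W / p ^ 2) = W by field_simp,
    hinv, sum_stdAddChar_mul_jacobiTheta₂ p hp hbc (im_pos_of_neg_inv hτ), jacobiTheta_neg_inv hτ0]
  have hroot : (-I * τ) ^ (1 / 2 : ℂ) / (-I * W) ^ (1 / 2 : ℂ) =
      ((2 * c * τ + p) / p) ^ (1 / 2 : ℂ) := by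
    rw [cpow_half_div_cpow_half (by simpa using hτ) (by simpa using hWim), hW]
    congr 1
    field_simp
  rw [← hroot]
  ring

/-- The transformation law of `thetaTwo` under `(a, 8b; 2c, p)` with `p` an odd prime. -/
theorem thetaTwo_moebius_prime (p : ℕ) [Fact p.Prime] (hp : p ≠ 2) {a b c : ℤ}
    (hdet : a * p - 8 * b * (2 * c) = 1) {τ : ℂ} (hτ : 0 < τ.im)
    (hγ : 0 < ((a * τ + 8 * b) / (2 * c * τ + p)).im) :
    thetaTwo ((a * τ + 8 * b) / (2 * c * τ + p)) =
      legendreSym p b * quadGaussSum p * ((2 * c * τ + p) / p) ^ (1 / 2 : ℂ) * thetaTwo τ := by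
  have h4 : 0 < (τ / 4).im := by
    rw [show τ / 4 = ((1 / 4 : ℝ) : ℂ) * τ by push_cast; ring, Complex.im_ofReal_mul]
    positivity
  -- In the variable `τ/4` the matrix becomes `(a, 2b; 8c, p)`. The two laws for `θ` have the same
  -- multiplier because `4` is a square, so they can be subtracted.
  have h1 := jacobiTheta_moebius_prime p hp (a := a) (b := b) (c := 4 * c)
    (by linear_combination hdet) h4
  have h2 := jacobiTheta_moebius_prime p hp (a := a) (b := 4 * b) (c := c)
    (by linear_combination hdet) hτ
  have hleg : legendreSym p (4 * b) = legendreSym p b := by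
    have h20 : ((2 : ℤ) : ZMod p) ≠ 0 := by
      intro h
      rw [ZMod.intCast_zmod_eq_zero_iff_dvd] at h
      have := (Nat.prime_dvd_prime_iff_eq Fact.out Nat.prime_two).mp (by exact_mod_cast h)
      exact hp this
    rw [legendreSym.mul, show (4 : ℤ) = 2 ^ 2 by norm_num, legendreSym.sq_one' p h20, one_mul]
  rw [hleg] at h2
  push_cast at h1 h2
  rw [show (2 * (4 * c) * (τ / 4) + p : ℂ) = 2 * c * τ + p by ring,
    show (a * (τ / 4) + 2 * b : ℂ) / (2 * c * τ + p) = (a * τ + 8 * b) / (2 * c * τ + p) / 4 by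
      ring, jacobiTheta_div_four hγ, jacobiTheta_div_four hτ] at h1
  rw [show (a * τ + 2 * (4 * b) : ℂ) = a * τ + 8 * b by ring] at h2
  linear_combination h1 - h2

end Transformation

/-! ### The Kronecker symbol as a Dirichlet character -/

section KroneckerCharacter

theorem exists_dirichletCharacter_of_periodic {N : ℕ} [NeZero N] (g : ℤ → ℤ) (h1 : g 1 = 1)
    (hmul : ∀ m n, g (m * n) = g m * g n) (hper : ∀ m n, m ≡ n [ZMOD N] → g m = g n)
    (hzero : ∀ n : ℤ, ¬ IsCoprime n N → g n = 0) :
    ∃ χ : DirichletCharacter ℂ N, ∀ n : ℤ, χ (n : ZMod N) = g n := by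
  have hval : ∀ n : ℤ, g ((n : ZMod N).val : ℤ) = g n := fun n ↦ hper _ _ (by
    rw [ZMod.val_intCast]
    exact Int.mod_modEq n N)
  have hcast : ∀ x : ZMod N, ∃ n : ℤ, (n : ZMod N) = x := ZMod.intCast_surjective
  let χ : DirichletCharacter ℂ N :=
    { toFun := fun x ↦ (g (x.val : ℤ) : ℂ)
      map_one' := by
        have := hval 1
        rw [Int.cast_one] at this
        rw [this, h1, Int.cast_one]
      map_mul' := fun x y ↦ by
        obtain ⟨m, rfl⟩ := hcast x
        obtain ⟨n, rfl⟩ := hcast y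
        rw [← Int.cast_mul, hval, hval, hval, hmul, Int.cast_mul]
      map_nonunit' := fun x hx ↦ by
        obtain ⟨n, rfl⟩ := hcast x
        rw [ZMod.coe_int_isUnit_iff_isCoprime, isCoprime_comm] at hx
        change ((g ((n : ZMod N).val : ℤ) : ℤ) : ℂ) = 0
        rw [hval, hzero n hx, Int.cast_zero] }
  exact ⟨χ, fun n ↦ congrArg (Int.cast (R := ℂ)) (hval n)⟩

theorem chi_four_intCast_sq_of_odd {n : ℤ} (hn : Odd n) : ZMod.χ₄ (n : ZMod 4) ^ 2 = 1 := by
  rw [ZMod.χ₄_int_eq_if_mod_four, if_neg (by rw [Int.odd_iff] at hn; omega)]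
  split_ifs <;> norm_num

theorem chi_four_intCast_of_even {n : ℤ} (hn : Even n) : ZMod.χ₄ (n : ZMod 4) = 0 := by
  rw [ZMod.χ₄_int_eq_if_mod_four, if_pos (Int.even_iff.mp hn)]

theorem chi_eight_intCast_sq_of_odd {n : ℤ} (hn : Odd n) : ZMod.χ₈ (n : ZMod 8) ^ 2 = 1 := by
  rw [ZMod.χ₈_int_eq_if_mod_eight, if_neg (by rw [Int.odd_iff] at hn; omega)]
  split_ifs <;> norm_num

theorem pow_eq_pow_of_sq_eq_one {x : ℤ} (hx : x ^ 2 = 1) {m n : ℕ} (h : m % 2 = n % 2) :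
    x ^ m = x ^ n := by
  rw [← Nat.div_add_mod m 2, ← Nat.div_add_mod n 2, pow_add, pow_add, pow_mul, pow_mul, hx,
    one_pow, one_pow, h]

/-- Reciprocity for the odd part of `c`, the supplementary law for its power of two. Negative `n`
obeys the same formula, since the signs from `χ₄` and from the Jacobi symbol of `-1` cancel. -/
theorem jacobiSym_natAbs_right (c : ℕ) (hc : c ≠ 0) {n : ℤ} (hn : Odd n) :
    jacobiSym c n.natAbs = ZMod.χ₈ (n : ZMod 8) ^ c.factorization 2 *
      ZMod.χ₄ (n : ZMod 4) ^ (ordCompl[2] c / 2) * jacobiSym n (ordCompl[2] c) := by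
  have hm : Odd (ordCompl[2] c) := by
    rw [← Nat.not_even_iff_odd, even_iff_two_dvd]
    exact Nat.not_dvd_ordCompl Nat.prime_two hc
  have key : ∀ b : ℕ, Odd b → jacobiSym c b = ZMod.χ₈ (b : ZMod 8) ^ c.factorization 2 *
      ZMod.χ₄ (b : ZMod 4) ^ (ordCompl[2] c / 2) * jacobiSym b (ordCompl[2] c) := by
    intro b hb
    conv_lhs => rw [← Nat.ordProj_mul_ordCompl_eq_self c 2]
    rw [Nat.cast_mul, Nat.cast_pow, jacobiSym.mul_left, jacobiSym.pow_left, Nat.cast_two,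
      jacobiSym.at_two hb, jacobiSym.quadratic_reciprocity hm hb,
      ZMod.χ₄_eq_neg_one_pow (Nat.odd_iff.mp hb), mul_assoc, mul_comm (ordCompl[2] c / 2), pow_mul]
  have hb : Odd n.natAbs := hn.natAbs
  rw [key _ hb]
  have habs := Int.natAbs_eq n
  generalize n.natAbs = b at hb habs
  rcases habs with rfl | rfl
  · simp
  · push_cast
    have h8 : ZMod.χ₈ (-(b : ZMod 8)) = ZMod.χ₈ (b : ZMod 8) := by
      rw [neg_eq_neg_one_mul, map_mul, show ZMod.χ₈ (-1) = 1 from rfl, one_mul]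
    have h4 : ZMod.χ₄ (-(b : ZMod 4)) = -1 * ZMod.χ₄ (b : ZMod 4) := by
      rw [neg_eq_neg_one_mul, map_mul, show ZMod.χ₄ (-1) = -1 from rfl]
    rw [jacobiSym.neg _ hm, h8, h4, mul_pow,
      ZMod.χ₄_eq_neg_one_pow (Nat.odd_iff.mp hm)]
    have hs : ((-1 : ℤ) ^ (ordCompl[2] c / 2)) * (-1) ^ (ordCompl[2] c / 2) = 1 := by
      rw [← mul_pow]
      norm_num
    linear_combination -(ZMod.χ₈ (b : ZMod 8) ^ c.factorization 2 *
      ZMod.χ₄ (b : ZMod 4) ^ (ordCompl[2] c / 2) * jacobiSym b (ordCompl[2] c)) * hs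

variable {k : ℕ} (c : Fin k → ℕ)

/-- The Kronecker symbol `((-1)^(k/2) 4 c₁⋯c_k / n)` with the dependence on `n` made explicit. -/
def reciprocalSym (n : ℤ) : ℤ :=
  -- The summand `2` changes nothing at odd `n` but keeps the exponent positive, so the value at
  -- even `n` is zero.
  ZMod.χ₄ (n : ZMod 4) ^ (k / 2 + ∑ i, ordCompl[2] (c i) / 2 + 2) *
    ZMod.χ₈ (n : ZMod 8) ^ (∑ i, (c i).factorization 2) * ∏ i, jacobiSym n (ordCompl[2] (c i))

theorem jacobiSym_prod_left {ι : Type*} (s : Finset ι) (a : ι → ℤ) (b : ℕ) :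
    jacobiSym (∏ i ∈ s, a i) b = ∏ i ∈ s, jacobiSym (a i) b := by
  classical
  induction s using Finset.induction_on with
  | empty => simp [jacobiSym.one_left]
  | insert i s hi ih => rw [Finset.prod_insert hi, Finset.prod_insert hi, jacobiSym.mul_left, ih]

theorem reciprocalSym_eq_kroneckerSym (hc : ∀ i, 0 < c i) (n : ℤ) :
    reciprocalSym c n = kroneckerSym ((-1) ^ (k / 2) * 4 * ∏ i, (c i : ℤ)) n := by
  have hP : (0 : ℤ) < ∏ i, (c i : ℤ) := Finset.prod_pos fun i _ ↦ by exact_mod_cast hc i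
  rcases Int.even_or_odd n with hn | hn
  · rw [reciprocalSym, chi_four_intCast_of_even hn, pow_add, kroneckerSym]
    split_ifs with h0 h1
    · rw [Int.natAbs_mul, Int.natAbs_mul] at h1
      have := Nat.eq_one_of_mul_eq_one_right h1
      simp [Int.natAbs_pow] at this
    · simp
    all_goals
      have h8 : ZMod.χ₈ ((((-1) ^ (k / 2) * 4 * ∏ i, (c i : ℤ) : ℤ)) : ZMod 8) = 0 := by
        rw [ZMod.χ₈_int_eq_if_mod_eight, if_pos]
        have : (2 : ℤ) ∣ (-1) ^ (k / 2) * 4 * ∏ i, (c i : ℤ) :=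
          Dvd.dvd.mul_right (Dvd.dvd.mul_left (by norm_num) _) _
        omega
      have hv : padicValNat 2 n.natAbs ≠ 0 := by
        rw [← Nat.pos_iff_ne_zero]
        exact one_le_padicValNat_of_dvd (by omega)
          (even_iff_two_dvd.mp (Int.natAbs_even.mpr hn))
      rw [h8, zero_pow hv]
      simp
  · have h0 : n ≠ 0 := by rintro rfl; simp at hn
    have hb : Odd n.natAbs := hn.natAbs
    have hv : padicValNat 2 n.natAbs = 0 :=
      padicValNat.eq_zero_of_not_dvd fun h ↦ (Nat.not_even_iff_odd.mpr hb) (even_iff_two_dvd.mpr h)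
    rw [kroneckerSym, if_neg h0, hv, pow_zero, pow_zero, Nat.div_one, mul_one, jacobiSym.mul_left,
      jacobiSym.mul_left, jacobiSym.at_four hb, mul_one, jacobiSym.pow_left,
      jacobiSym.at_neg_one hb, jacobiSym_prod_left]
    simp only [jacobiSym_natAbs_right _ (hc _).ne' hn]
    rw [Finset.prod_mul_distrib, Finset.prod_mul_distrib, Finset.prod_pow_eq_pow_sum,
      Finset.prod_pow_eq_pow_sum, reciprocalSym, pow_add, pow_add, chi_four_intCast_sq_of_odd hn]
    -- The factor for negative `n` is the sign `(-1)^{k/2}` of `D`, which is what `χ₄(-1)^{k/2}`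
    -- contributes.
    have hsign : (if n < 0 ∧ (-1) ^ (k / 2) * 4 * ∏ i, (c i : ℤ) < 0 then -1 else 1) *
        ZMod.χ₄ (n.natAbs : ZMod 4) ^ (k / 2) = ZMod.χ₄ (n : ZMod 4) ^ (k / 2) := by
      rcases Int.natAbs_eq n with h | h
      · rw [if_neg (by omega), one_mul]
        conv_rhs => rw [h]
        simp
      · have h4 : ZMod.χ₄ (n : ZMod 4) = -1 * ZMod.χ₄ (n.natAbs : ZMod 4) := by
          conv_lhs => rw [h]
          rw [Int.cast_neg, Int.cast_natCast, neg_eq_neg_one_mul, map_mul,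
            show ZMod.χ₄ (-1) = -1 from rfl]
        rw [h4, mul_pow]
        congr 1
        rcases Nat.even_or_odd (k / 2) with he | ho
        · rw [he.neg_one_pow, if_neg]
          rintro ⟨-, h2⟩
          linarith
        · rw [ho.neg_one_pow, if_pos]
          exact ⟨by omega, by linarith⟩
    rw [← hsign]
    ring

theorem reciprocalSym_one : reciprocalSym c 1 = 1 := by
  simp [reciprocalSym, jacobiSym.one_left]

theorem reciprocalSym_mul (m n : ℤ) :
    reciprocalSym c (m * n) = reciprocalSym c m * reciprocalSym c n := by
  simp only [reciprocalSym, Int.cast_mul, map_mul, mul_pow, jacobiSym.mul_left,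
    Finset.prod_mul_distrib]
  ring

/-- For odd `c_i` the sum in question equals `h/2`, a multiple of 4. -/
theorem even_half_add_sum_of_odd (hk : Even k) (hodd : ∀ i, Odd (c i))
    (h : (∑ i, c i) ≡ 0 [MOD 8]) : Even (k / 2 + ∑ i, ordCompl[2] (c i) / 2) := by
  have h1 : ∀ i, ordCompl[2] (c i) = c i := fun i ↦ by
    rw [Nat.factorization_eq_zero_of_not_dvd fun h2 ↦
      Nat.not_even_iff_odd.mpr (hodd i) (even_iff_two_dvd.mpr h2), pow_zero, Nat.div_one]
  simp only [h1]
  have h2 : ∑ i, c i = 2 * ∑ i, c i / 2 + k := by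
    calc ∑ i, c i = ∑ i, (2 * (c i / 2) + 1) := Finset.sum_congr rfl fun i _ ↦ by
          have := Nat.odd_iff.mp (hodd i); omega
      _ = _ := by rw [Finset.sum_add_distrib, ← Finset.mul_sum]; simp
  have h3 := Nat.even_iff.mp hk
  rw [h2, Nat.ModEq] at h
  rw [Nat.even_iff]
  omega

/-- When `4 ∤ c_i`, the integer `c_i + v₂(c_i)` is odd. An even number of these has even sum, and
`h` is even. -/
theorem even_sum_factorization_two (hk : Even k) (hc : ∀ i, 0 < c i) (h4 : ∀ i, ¬ 4 ∣ c i)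
    (h : (∑ i, c i) ≡ 0 [MOD 8]) : Even (∑ i, (c i).factorization 2) := by
  have h1 : ∀ i, Odd (c i + (c i).factorization 2) := fun i ↦ by
    have hlt : (c i).factorization 2 < 2 := by
      by_contra! h2
      exact h4 i (((Nat.prime_two.pow_dvd_iff_le_factorization (hc i).ne').mpr h2))
    have hpos : 0 < (c i).factorization 2 ↔ 2 ∣ c i := by
      rw [← Nat.succ_le_iff]
      simpa using (Nat.prime_two.pow_dvd_iff_le_factorization (k := 1) (hc i).ne').symm
    rw [Nat.odd_iff]
    rcases Nat.eq_zero_or_pos ((c i).factorization 2) with h0 | h0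
    · have : ¬ 2 ∣ c i := fun h2 ↦ by have := hpos.mpr h2; omega
      omega
    · have := hpos.mp h0
      omega
  have h2 : ∑ i, c i + ∑ i, (c i).factorization 2 =
      2 * (∑ i, (c i + (c i).factorization 2) / 2) + k := by
    rw [← Finset.sum_add_distrib]
    calc _ = ∑ i, (2 * ((c i + (c i).factorization 2) / 2) + 1) := Finset.sum_congr rfl fun i _ ↦ by
          have := Nat.odd_iff.mp (h1 i); omega
      _ = _ := by rw [Finset.sum_add_distrib, ← Finset.mul_sum]; simp
  have h3 := Nat.even_iff.mp hk
  rw [Nat.ModEq] at h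
  rw [Nat.even_iff]
  omega

/-- If some `c_i` is even then `4 ∣ N`, and if some `c_i` is divisible by 4 then `8 ∣ N`, so `χ₄` or
`χ₈` is periodic. Otherwise `8 ∣ h` makes the corresponding exponent even, and the factor is trivial
on odd integers. -/
theorem reciprocalSym_periodic (hk : Even k) (hc : ∀ i, 0 < c i)
    (h : (∑ i, c i) ≡ 0 [MOD 8]) {m n : ℤ}
    (hmn : m ≡ n [ZMOD (2 * Finset.univ.lcm c : ℕ)]) : reciprocalSym c m = reciprocalSym c n := by
  have hdvd : ∀ i, c i ∣ Finset.univ.lcm c := fun i ↦ Finset.dvd_lcm (Finset.mem_univ i)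
  have h2 : m ≡ n [ZMOD 2] := hmn.of_dvd (by push_cast; exact Dvd.intro _ rfl)
  have hJ : ∀ i, jacobiSym m (ordCompl[2] (c i)) = jacobiSym n (ordCompl[2] (c i)) := fun i ↦
    jacobiSym.mod_left' (hmn.of_dvd (Int.natCast_dvd_natCast.mpr
      (((Nat.ordCompl_dvd (c i) 2).trans (hdvd i)).mul_left 2)))
  rcases Int.even_or_odd m with hm | hm
  · have hn : Even n := by
      rw [Int.even_iff] at hm ⊢
      have h2' : m % 2 = n % 2 := h2
      omega
    simp [reciprocalSym, chi_four_intCast_of_even hm, chi_four_intCast_of_even hn]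
  have hn : Odd n := by
    rw [Int.odd_iff] at hm ⊢
    have h2' : m % 2 = n % 2 := h2
    omega
  have hχ₄ : ZMod.χ₄ (m : ZMod 4) ^ (k / 2 + ∑ i, ordCompl[2] (c i) / 2 + 2) =
      ZMod.χ₄ (n : ZMod 4) ^ (k / 2 + ∑ i, ordCompl[2] (c i) / 2 + 2) := by
    by_cases hodd : ∀ i, Odd (c i)
    · have he := (even_half_add_sum_of_odd c hk hodd h).add even_two
      rw [pow_eq_pow_of_sq_eq_one (chi_four_intCast_sq_of_odd hm) (n := 0) (Nat.even_iff.mp he),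
        pow_eq_pow_of_sq_eq_one (chi_four_intCast_sq_of_odd hn) (n := 0) (Nat.even_iff.mp he),
        pow_zero, pow_zero]
    · push Not at hodd
      obtain ⟨i, hi⟩ := hodd
      have h4 : 4 ∣ 2 * Finset.univ.lcm c := mul_dvd_mul (dvd_refl 2)
        ((even_iff_two_dvd.mp (Nat.not_odd_iff_even.mp hi)).trans (hdvd i))
      rw [(ZMod.intCast_eq_intCast_iff m n 4).mpr (hmn.of_dvd (Int.natCast_dvd_natCast.mpr h4))]
  have hχ₈ : ZMod.χ₈ (m : ZMod 8) ^ (∑ i, (c i).factorization 2) =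
      ZMod.χ₈ (n : ZMod 8) ^ (∑ i, (c i).factorization 2) := by
    by_cases h4 : ∀ i, ¬ 4 ∣ c i
    · have he := even_sum_factorization_two c hk hc h4 h
      rw [pow_eq_pow_of_sq_eq_one (chi_eight_intCast_sq_of_odd hm) (n := 0) (Nat.even_iff.mp he),
        pow_eq_pow_of_sq_eq_one (chi_eight_intCast_sq_of_odd hn) (n := 0) (Nat.even_iff.mp he),
        pow_zero, pow_zero]
    · push Not at h4
      obtain ⟨i, hi⟩ := h4
      have h8 : 8 ∣ 2 * Finset.univ.lcm c := mul_dvd_mul (dvd_refl 2) (hi.trans (hdvd i))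
      rw [(ZMod.intCast_eq_intCast_iff m n 8).mpr (hmn.of_dvd (Int.natCast_dvd_natCast.mpr h8))]
  rw [reciprocalSym, reciprocalSym, hχ₄, hχ₈, Finset.prod_congr rfl fun i _ ↦ hJ i]

theorem reciprocalSym_eq_zero (hc : ∀ i, 0 < c i) {n : ℤ}
    (hn : ¬ IsCoprime n (2 * Finset.univ.lcm c : ℕ)) : reciprocalSym c n = 0 := by
  rcases Int.even_or_odd n with he | ho
  · simp [reciprocalSym, chi_four_intCast_of_even he]
  rw [Int.isCoprime_iff_gcd_eq_one, Int.gcd_eq_natAbs, Int.natAbs_natCast] at hn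
  obtain ⟨q, hq, hqn, hqN⟩ := Nat.Prime.not_coprime_iff_dvd.mp hn
  have hq2 : q ≠ 2 := by
    rintro rfl
    exact Nat.not_even_iff_odd.mpr ho.natAbs (even_iff_two_dvd.mpr hqn)
  have hql : q ∣ Finset.univ.lcm c := ((Nat.Prime.dvd_mul hq).mp hqN).resolve_left fun h ↦
    hq2 ((Nat.prime_dvd_prime_iff_eq hq Nat.prime_two).mp h)
  obtain ⟨i, hi⟩ : ∃ i, q ∣ c i := by
    have := hql.trans (Finset.lcm_dvd (fun i _ ↦ Finset.dvd_prod_of_mem c (Finset.mem_univ i)))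
    obtain ⟨i, -, hi⟩ := (Prime.dvd_finsetProd_iff hq.prime c).mp this
    exact ⟨i, hi⟩
  have hqm : q ∣ ordCompl[2] (c i) := by
    rw [← Nat.ordProj_mul_ordCompl_eq_self (c i) 2] at hi
    refine ((Nat.Prime.dvd_mul hq).mp hi).resolve_left fun h ↦ hq2 ?_
    exact (Nat.prime_dvd_prime_iff_eq hq Nat.prime_two).mp (hq.dvd_of_dvd_pow h)
  have h0 : jacobiSym n (ordCompl[2] (c i)) = 0 := by
    rw [jacobiSym.eq_zero_iff]
    refine ⟨(Nat.ordCompl_pos 2 (hc i).ne').ne', fun h1 ↦ hq.one_lt.ne' ?_⟩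
    rw [Int.gcd_eq_natAbs, Int.natAbs_natCast] at h1
    exact Nat.eq_one_of_dvd_one (h1 ▸ Nat.dvd_gcd hqn hqm)
  rw [reciprocalSym, Finset.prod_eq_zero (Finset.mem_univ i) h0, mul_zero]

theorem lcm_ne_zero_of_pos (hc : ∀ i, 0 < c i) : Finset.univ.lcm c ≠ 0 := by
  rw [Ne, Finset.lcm_eq_zero_iff]
  rintro ⟨i, -, hi⟩
  exact (hc i).ne' hi

theorem exists_kroneckerSym_character (hk : Even k) (hc : ∀ i, 0 < c i)
    (h : (∑ i, c i) ≡ 0 [MOD 8]) :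
    ∃ χ : DirichletCharacter ℂ (2 * Finset.univ.lcm c),
      ∀ d : ℤ, χ (d : ZMod (2 * Finset.univ.lcm c)) =
        (kroneckerSym ((-1) ^ (k / 2) * 4 * ∏ i, (c i : ℤ)) d : ℂ) := by
  have : NeZero (2 * Finset.univ.lcm c) := ⟨mul_ne_zero two_ne_zero (lcm_ne_zero_of_pos c hc)⟩
  obtain ⟨χ, hχ⟩ := exists_dirichletCharacter_of_periodic (reciprocalSym c) (reciprocalSym_one c)
    (reciprocalSym_mul c) (fun m n hmn ↦ reciprocalSym_periodic c hk hc h hmn)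
    (fun n hn ↦ reciprocalSym_eq_zero c hc hn)
  exact ⟨χ, fun d ↦ by rw [hχ, reciprocalSym_eq_kroneckerSym c hc]⟩

end KroneckerCharacter

/-! ### Modularity of the product of theta constants -/

section ThetaProduct

variable {k : ℕ} (c : Fin k → ℕ)

/-- The product `∏ i, θ₂(c_i τ)` as a function on the upper half plane. -/
noncomputable def thetaTwoProd (τ : ℍ) : ℂ := ∏ i, thetaTwo (c i * τ)

theorem im_natCast_mul_pos {m : ℕ} (hm : 0 < m) {z : ℂ} (hz : 0 < z.im) : 0 < ((m : ℂ) * z).im := by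
  rw [show (m : ℂ) = ((m : ℝ) : ℂ) by push_cast; rfl, Complex.im_ofReal_mul]
  have : (0 : ℝ) < m := Nat.cast_pos.mpr hm
  positivity

theorem exp_mul_triangularPsiProd (hc : ∀ i, 0 < c i) (τ : ℍ) :
    Complex.exp (2 * Real.pi * Complex.I * (τ : ℂ) * ((∑ i, c i : ℕ) / 8 : ℂ))
      * triangularPsiProd c (τ : ℂ) = (1 / 2) ^ k * thetaTwoProd c τ := by
  rw [thetaTwoProd, Finset.prod_congr rfl fun i _ ↦
    thetaTwo_eq_triangularPsi (im_natCast_mul_pos (hc i) τ.im_pos), Finset.prod_mul_distrib,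
    Finset.prod_mul_distrib, Finset.prod_const, Finset.card_univ, Fintype.card_fin,
    ← Complex.exp_sum, triangularPsiProd, ← mul_assoc, ← mul_pow,
    show (1 / 2 * 2 : ℂ) = 1 by norm_num, one_pow, one_mul]
  congr 2
  rw [← Finset.sum_div]
  simp only [← mul_assoc]
  rw [← Finset.sum_mul, ← Finset.mul_sum]
  push_cast
  ring

theorem thetaTwo_add_natCast (τ : ℂ) (n : ℕ) :
    thetaTwo (τ + n) = cexp (Real.pi * I / 4 * n) * thetaTwo τ := by
  induction n with
  | zero => simp
  | succ n ih =>
    rw [Nat.cast_succ, ← add_assoc, thetaTwo_add_one, ih, ← mul_assoc, ← Complex.exp_add]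
    ring_nf

theorem coe_T_smul (τ : ℍ) : ((ModularGroup.T • τ : ℍ) : ℂ) = τ + 1 := by
  rw [modular_T_smul, coe_vadd]
  push_cast
  ring

theorem thetaTwoProd_T_smul (τ : ℍ) : thetaTwoProd c (ModularGroup.T • τ) =
    cexp (2 * Real.pi * I * ((∑ i, c i : ℕ) / 8 : ℂ)) * thetaTwoProd c τ := by
  simp only [thetaTwoProd, coe_T_smul, mul_add, mul_one, thetaTwo_add_natCast]
  rw [Finset.prod_mul_distrib, ← Complex.exp_sum, ← Finset.mul_sum]
  congr 2
  push_cast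
  ring

theorem denom_T (τ : ℍ) : denom (ModularGroup.T : GL (Fin 2) ℝ) τ = 1 := by
  rw [ModularGroup.denom_apply]
  simp [ModularGroup.T]

theorem thetaTwoProd_slash_T (h : (∑ i, c i) ≡ 0 [MOD 8]) (w : ℤ) :
    thetaTwoProd c ∣[w] ModularGroup.T = thetaTwoProd c := by
  ext τ
  obtain ⟨m, hm⟩ := (Nat.modEq_zero_iff_dvd.mp h)
  have hexp : cexp (2 * Real.pi * I * ((∑ i, c i : ℕ) / 8 : ℂ)) = 1 := by
    rw [hm, Complex.exp_eq_one_iff]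
    exact ⟨m, by push_cast; ring⟩
  rw [ModularForm.SL_slash_apply, thetaTwoProd_T_smul, hexp, denom_T, one_zpow, mul_one, one_mul]

theorem thetaTwoProd_slash_T_zpow (h : (∑ i, c i) ≡ 0 [MOD 8]) (w n : ℤ) :
    thetaTwoProd c ∣[w] (ModularGroup.T ^ n) = thetaTwoProd c := by
  have hT := thetaTwoProd_slash_T c h w
  induction n using Int.induction_on with
  | zero => rw [zpow_zero, SlashAction.slash_one]
  | succ n ih => rw [zpow_add_one, SlashAction.slash_mul, ih, hT]
  | pred n ih =>
    rw [zpow_sub_one, SlashAction.slash_mul, ih]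
    conv_lhs => rw [← hT]
    rw [← SlashAction.slash_mul, mul_inv_cancel, SlashAction.slash_one]

theorem legendreSym_prod {p : ℕ} [Fact p.Prime] {ι : Type*} (s : Finset ι) (a : ι → ℤ) :
    legendreSym p (∏ i ∈ s, a i) = ∏ i ∈ s, legendreSym p (a i) := by
  simp only [jacobiSym.legendreSym.to_jacobiSym, jacobiSym_prod_left]

theorem coe_SL_smul (γ : SL(2, ℤ)) (τ : ℍ) :
    ((γ • τ : ℍ) : ℂ) = (γ 0 0 * τ + γ 0 1) / (γ 1 0 * τ + γ 1 1) := by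
  rw [coe_specialLinearGroup_apply]
  simp

theorem det_SL_eq_one (γ : SL(2, ℤ)) : γ 0 0 * γ 1 1 - γ 0 1 * γ 1 0 = 1 := by
  have := γ.det_coe
  rwa [Matrix.det_fin_two] at this

/-- Conjugation by `diag(m, 1)` turns `γ` into an integral matrix with upper right entry `8bm` and
even lower left entry; this is where the factor 2 in `N` is needed. -/
theorem thetaTwo_natCast_mul_SL_smul {p : ℕ} [Fact p.Prime] (hp : p ≠ 2) {m : ℕ} (hm : 0 < m)
    {γ : SL(2, ℤ)} {b : ℤ} (hγp : γ 1 1 = p) (hγb : γ 0 1 = 8 * b) (hγc : (2 * m : ℤ) ∣ γ 1 0)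
    (τ : ℍ) : thetaTwo (m * ↑(γ • τ)) = legendreSym p (b * m) * quadGaussSum p *
      (denom γ τ / p) ^ (1 / 2 : ℂ) * thetaTwo (m * τ) := by
  obtain ⟨e, he⟩ := hγc
  have hdet := det_SL_eq_one γ
  rw [hγp, hγb, he] at hdet
  have hm0 : (m : ℂ) ≠ 0 := Nat.cast_ne_zero.mpr hm.ne'
  have harg : (m * ↑(γ • τ) : ℂ) =
      (γ 0 0 * (m * τ) + 8 * (b * m : ℤ)) / (2 * e * (m * τ) + p) := by
    rw [coe_SL_smul, hγp, hγb, he]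
    push_cast
    rw [mul_div_assoc']
    congr 1 <;> ring
  have hden : denom γ τ = 2 * e * (m * τ) + p := by
    rw [ModularGroup.denom_apply, hγp, he]
    push_cast
    ring
  have him := im_natCast_mul_pos hm (γ • τ).im_pos
  rw [harg] at him ⊢
  rw [hden]
  exact thetaTwo_moebius_prime p hp (by linear_combination hdet)
    (im_natCast_mul_pos hm τ.im_pos) him

theorem legendreSym_eq_kroneckerSym {p : ℕ} [Fact p.Prime] (hp : p ≠ 2) (a : ℤ) :
    legendreSym p a = kroneckerSym (a * 4) p := by
  have hpp : p.Prime := Fact.out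
  have hodd : Odd p := hpp.odd_of_ne_two hp
  have hv : padicValNat 2 p = 0 := padicValNat.eq_zero_of_not_dvd fun h ↦
    hp ((Nat.prime_dvd_prime_iff_eq Nat.prime_two hpp).mp h).symm
  rw [kroneckerSym, if_neg (by exact_mod_cast hpp.ne_zero), if_neg (by omega), Int.natAbs_natCast,
    hv, pow_zero, pow_zero, Nat.div_one, jacobiSym.mul_left, jacobiSym.at_four hodd,
    jacobiSym.legendreSym.to_jacobiSym]
  ring

theorem thetaTwoProd_slash_prime (hk : Even k) (hc : ∀ i, 0 < c i) {p : ℕ} [Fact p.Prime]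
    (hp : p ≠ 2) {γ : SL(2, ℤ)} (hγ : γ ∈ CongruenceSubgroup.Gamma0 (2 * Finset.univ.lcm c))
    (hγp : γ 1 1 = p) (hγb : 8 ∣ γ 0 1) :
    thetaTwoProd c ∣[((k / 2 : ℕ) : ℤ)] γ =
      (kroneckerSym ((-1) ^ (k / 2) * 4 * ∏ i, (c i : ℤ)) p : ℂ) • thetaTwoProd c := by
  obtain ⟨b, hb⟩ := hγb
  obtain ⟨l, rfl⟩ := hk
  have hl : (l + l) / 2 = l := by omega
  have hp0 : (p : ℂ) ≠ 0 := Nat.cast_ne_zero.mpr (Fact.out : p.Prime).ne_zero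
  rw [CongruenceSubgroup.Gamma0_mem, ZMod.intCast_zmod_eq_zero_iff_dvd] at hγ
  have hdvd : ∀ i, (2 * c i : ℤ) ∣ γ 1 0 := fun i ↦ dvd_trans (by
    push_cast
    exact mul_dvd_mul_left 2 (Int.natCast_dvd_natCast.mpr (Finset.dvd_lcm (Finset.mem_univ i)))) hγ
  have hbp : (b : ZMod p) ≠ 0 := by
    intro h0
    have := congrArg (Int.cast (R := ZMod p)) (det_SL_eq_one γ)
    rw [hγp, hb] at this
    push_cast at this
    simp [h0] at this
  have hb2 : (legendreSym p b : ℂ) ^ 2 = 1 := by exact_mod_cast legendreSym.sq_one p hbp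
  have hG : quadGaussSum p ^ 2 = legendreSym p (-1) * p := quadGaussSum_sq p hp
  have hleg : legendreSym p ((-1) ^ l * ∏ i, (c i : ℤ)) =
      legendreSym p (-1) ^ l * ∏ i, legendreSym p (c i) := by
    rw [legendreSym.mul, legendreSym_prod]
    congr 1
    exact map_pow (legendreSym.hom p) (-1) l
  ext τ
  have hden := denom_ne_zero γ τ
  have hroot : ((denom γ τ / p) ^ (1 / 2 : ℂ)) ^ 2 = denom γ τ / p := by
    rw [← Complex.cpow_nat_mul]
    norm_num
  rw [ModularForm.SL_slash_apply, hl, Pi.smul_apply, smul_eq_mul, mul_right_comm ((-1) ^ l),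
    ← legendreSym_eq_kroneckerSym hp, hleg, thetaTwoProd]
  simp only [thetaTwo_natCast_mul_SL_smul hp (hc _) hγp hb (hdvd _), legendreSym.mul, Int.cast_mul]
  simp only [Finset.prod_mul_distrib, Finset.prod_const, Finset.card_univ, Fintype.card_fin]
  have hsq : ∀ x : ℂ, x ^ (l + l) = (x ^ 2) ^ l := fun x ↦ by rw [← two_mul, pow_mul]
  rw [hsq, hsq, hsq, hb2, hG, hroot, thetaTwoProd, zpow_neg, zpow_natCast]
  generalize ∏ i, thetaTwo (c i * (τ : ℂ)) = P
  push_cast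
  rw [one_pow, mul_pow, div_pow]
  field_simp

/-- Translations fix the product and do not change the lower left entry, so `γ` may be replaced by
`T^m γ T^n` with prime lower right entry `p` and upper right entry divisible by 8. -/
theorem thetaTwoProd_slash_of_lower_left_ne_zero (hk : Even k) (hc : ∀ i, 0 < c i)
    (h : (∑ i, c i) ≡ 0 [MOD 8]) {χ : DirichletCharacter ℂ (2 * Finset.univ.lcm c)}
    (hχ : ∀ d : ℤ, χ (d : ZMod (2 * Finset.univ.lcm c)) =
        (kroneckerSym ((-1) ^ (k / 2) * 4 * ∏ i, (c i : ℤ)) d : ℂ))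
    {γ : SL(2, ℤ)} (hγ : γ ∈ CongruenceSubgroup.Gamma0 (2 * Finset.univ.lcm c))
    (hγ0 : γ 1 0 ≠ 0) :
    thetaTwoProd c ∣[((k / 2 : ℕ) : ℤ)] γ =
      χ ((γ 1 1 : ℤ) : ZMod (2 * Finset.univ.lcm c)) • thetaTwoProd c := by
  have hdet := det_SL_eq_one γ
  obtain ⟨p, hp2, hp, hpmod⟩ := Nat.forall_exists_prime_gt_and_zmodEq 2
    (q := (γ 1 0).natAbs) (a := γ 1 1) (Int.natAbs_ne_zero.mpr hγ0) (by
      rw [Int.natCast_natAbs, IsCoprime.abs_right_iff]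
      exact ⟨γ 0 0, -γ 0 1, by linear_combination hdet⟩)
  have : Fact p.Prime := ⟨hp⟩
  obtain ⟨n, hn⟩ : ∃ n : ℤ, (p : ℤ) = γ 1 1 + γ 1 0 * n := by
    have hd : γ 1 0 ∣ (p : ℤ) - γ 1 1 := Int.natAbs_dvd.mp hpmod.symm.dvd
    obtain ⟨n, hn⟩ := hd
    exact ⟨n, by linear_combination hn⟩
  -- `T^m` on the left adds `m p` to the upper right entry, and `p` is invertible modulo 8.
  obtain ⟨m, hm⟩ : ∃ m : ℤ, (8 : ℤ) ∣ γ 0 0 * n + γ 0 1 + m * p := by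
    have hcop : IsCoprime (p : ℤ) 8 := by
      have : Nat.Coprime p (2 ^ 3) := (Nat.Coprime.pow_right 3
        ((Nat.coprime_primes hp Nat.prime_two).mpr hp2.ne'))
      exact_mod_cast this.isCoprime
    obtain ⟨u, v, huv⟩ := hcop
    refine ⟨-(γ 0 0 * n + γ 0 1) * u, (γ 0 0 * n + γ 0 1) * v, ?_⟩
    linear_combination -(γ 0 0 * n + γ 0 1) * huv
  set δ : SL(2, ℤ) := ModularGroup.T ^ m * γ * ModularGroup.T ^ n with hδ
  have h10 : δ 1 0 = γ 1 0 := by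
    simp only [hδ, Matrix.SpecialLinearGroup.coe_mul, Matrix.mul_apply, Fin.sum_univ_two,
      ModularGroup.coe_T_zpow]
    simp
  have h11 : δ 1 1 = p := by
    simp only [hδ, Matrix.SpecialLinearGroup.coe_mul, Matrix.mul_apply, Fin.sum_univ_two,
      ModularGroup.coe_T_zpow, hn]
    simp
    ring
  have h01 : 8 ∣ δ 0 1 := by
    have : δ 0 1 = γ 0 0 * n + γ 0 1 + m * p := by
      simp only [hδ, Matrix.SpecialLinearGroup.coe_mul, Matrix.mul_apply, Fin.sum_univ_two,
        ModularGroup.coe_T_zpow, hn]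
      simp
      ring
    rwa [this]
  have hδΓ : δ ∈ CongruenceSubgroup.Gamma0 (2 * Finset.univ.lcm c) := by
    rw [CongruenceSubgroup.Gamma0_mem] at hγ ⊢
    rwa [h10]
  have hchar : χ ((γ 1 1 : ℤ) : ZMod (2 * Finset.univ.lcm c)) = χ ((p : ℤ) : ZMod _) := by
    rw [CongruenceSubgroup.Gamma0_mem] at hγ
    rw [hn, Int.cast_add, Int.cast_mul, hγ, zero_mul, add_zero]
  have hslash := thetaTwoProd_slash_prime c hk hc hp2.ne' hδΓ h11 h01
  rw [← hχ, ← hchar, hδ, SlashAction.slash_mul, SlashAction.slash_mul,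
    thetaTwoProd_slash_T_zpow c h] at hslash
  have h2 := congrArg (· ∣[((k / 2 : ℕ) : ℤ)] (ModularGroup.T ^ (-n))) hslash
  simp only [← SlashAction.slash_mul, mul_assoc, ModularForm.SL_smul_slash,
    thetaTwoProd_slash_T_zpow c h] at h2
  rwa [← zpow_add, add_neg_cancel, zpow_zero, mul_one] at h2

theorem thetaTwoProd_slash_Gamma0 (hk : Even k) (hc : ∀ i, 0 < c i)
    (h : (∑ i, c i) ≡ 0 [MOD 8]) {χ : DirichletCharacter ℂ (2 * Finset.univ.lcm c)}
    (hχ : ∀ d : ℤ, χ (d : ZMod (2 * Finset.univ.lcm c)) =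
        (kroneckerSym ((-1) ^ (k / 2) * 4 * ∏ i, (c i : ℤ)) d : ℂ))
    {γ : SL(2, ℤ)} (hγ : γ ∈ CongruenceSubgroup.Gamma0 (2 * Finset.univ.lcm c)) :
    thetaTwoProd c ∣[((k / 2 : ℕ) : ℤ)] γ =
      χ ((γ 1 1 : ℤ) : ZMod (2 * Finset.univ.lcm c)) • thetaTwoProd c := by
  by_cases hγ0 : γ 1 0 = 0
  · have hN0 : ((2 * Finset.univ.lcm c : ℕ) : ℤ) ≠ 0 := by
      have := lcm_ne_zero_of_pos c hc
      exact_mod_cast mul_ne_zero two_ne_zero this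
    -- Dirichlet's theorem needs a nonzero modulus. Both `V` and `γ * V` have nonzero lower left
    -- entry, and `V` acts trivially.
    let V : SL(2, ℤ) := ⟨!![1, 0; ((2 * Finset.univ.lcm c : ℕ) : ℤ), 1], by simp [Matrix.det_fin_two]⟩
    have hdet := det_SL_eq_one γ
    rw [hγ0, mul_zero, sub_zero] at hdet
    have hd0 : γ 1 1 ≠ 0 := by
      intro h0
      simp [h0] at hdet
    have hV10 : V 1 0 = (2 * Finset.univ.lcm c : ℕ) := rfl
    have hV11 : V 1 1 = 1 := rfl
    have h10 : (γ * V) 1 0 = γ 1 1 * (2 * Finset.univ.lcm c : ℕ) := by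
      simp only [Matrix.SpecialLinearGroup.coe_mul, Matrix.mul_apply, Fin.sum_univ_two]
      simp [V, hγ0]
    have h11 : (γ * V) 1 1 = γ 1 1 := by
      simp only [Matrix.SpecialLinearGroup.coe_mul, Matrix.mul_apply, Fin.sum_univ_two]
      simp [V, hγ0]
    have hV : V ∈ CongruenceSubgroup.Gamma0 (2 * Finset.univ.lcm c) := by
      rw [CongruenceSubgroup.Gamma0_mem, hV10, Int.cast_natCast, ZMod.natCast_self]
    have hslashV := thetaTwoProd_slash_of_lower_left_ne_zero c hk hc h hχ hV (by rwa [hV10])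
    have hslash := thetaTwoProd_slash_of_lower_left_ne_zero c hk hc h hχ
      (mul_mem hγ hV) (by rw [h10]; exact mul_ne_zero hd0 hN0)
    rw [hV11, Int.cast_one, map_one, one_smul] at hslashV
    rw [h11, SlashAction.slash_mul] at hslash
    have h2 := congrArg (· ∣[((k / 2 : ℕ) : ℤ)] V⁻¹) hslash
    have h3 := congrArg (· ∣[((k / 2 : ℕ) : ℤ)] V⁻¹) hslashV
    simp only [← SlashAction.slash_mul, ModularForm.SL_smul_slash] at h2 h3
    rw [mul_inv_cancel, SlashAction.slash_one] at h3
    rwa [mul_inv_cancel_right, ← h3] at h2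
  · exact thetaTwoProd_slash_of_lower_left_ne_zero c hk hc h hχ hγ hγ0

/-! ### Holomorphy and growth at the cusps -/

theorem mdifferentiable_thetaTwoProd (hc : ∀ i, 0 < c i) :
    MDifferentiable (modelWithCornersSelf ℂ ℂ) (modelWithCornersSelf ℂ ℂ) (thetaTwoProd c) := by
  rw [UpperHalfPlane.mdifferentiable_iff]
  have hd : DifferentiableOn ℂ (fun z : ℂ ↦ ∏ i, thetaTwo (c i * z)) {z | 0 < z.im} := by
    intro z hz
    refine DifferentiableAt.differentiableWithinAt (DifferentiableAt.fun_finsetProd fun i _ ↦ ?_)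
    exact (differentiableAt_thetaTwo (im_natCast_mul_pos (hc i) hz)).comp z
      (f := fun z : ℂ ↦ (c i : ℂ) * z) (by fun_prop)
  refine hd.congr fun z hz ↦ ?_
  simp only [Function.comp_apply, thetaTwoProd, ofComplex_apply_of_im_pos hz]

/-- The point `m τ` of the upper half plane. -/
noncomputable def natScale {m : ℕ} (hm : 0 < m) (τ : ℍ) : ℍ := ⟨m * τ, im_natCast_mul_pos hm τ.im_pos⟩

theorem im_natScale {m : ℕ} (hm : 0 < m) (τ : ℍ) : (natScale hm τ).im = m * τ.im := by
  rw [← coe_im]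
  change ((m : ℂ) * τ).im = _
  rw [show (m : ℂ) = ((m : ℝ) : ℂ) by push_cast; rfl, Complex.im_ofReal_mul, coe_im]

theorem one_le_normSq_intCast_mul_add {τ : ℍ} (hτ : 1 ≤ τ.im) {u v : ℤ} (huv : u ≠ 0 ∨ v ≠ 0) :
    1 ≤ Complex.normSq (u * τ + v) := by
  have hre : ((u : ℂ) * τ + v).re = u * τ.re + v := by simp
  have him : ((u : ℂ) * τ + v).im = u * τ.im := by simp
  rw [Complex.normSq_apply, hre, him]
  by_cases hu : u = 0
  · have hv : (1 : ℝ) ≤ v * v := by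
      have : v ≠ 0 := huv.resolve_left (not_not.mpr hu)
      exact_mod_cast (Int.one_le_abs (mul_ne_zero this this)).trans_eq (abs_mul_self v)
    simp [hu, hv]
  · have hu' : (1 : ℝ) ≤ u * u := by
      exact_mod_cast (Int.one_le_abs (mul_ne_zero hu hu)).trans_eq (abs_mul_self u)
    have h1 : 1 ≤ τ.im * τ.im := by nlinarith
    nlinarith [mul_self_nonneg (u * τ.re + v : ℝ)]

/-- The bottom row of `δ · diag(m, 1) · γ` is integral and nonzero, so its automorphy factor at a
point of height at least 1 has norm at least 1. -/
theorem im_SL_smul_natScale_le {m : ℕ} (hm : 0 < m) (γ δ : SL(2, ℤ)) {τ : ℍ} (hτ : 1 ≤ τ.im) :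
    (δ • natScale hm (γ • τ)).im ≤ m * τ.im := by
  have hd := denom_ne_zero γ τ
  rw [ModularGroup.im_smul_eq_div_normSq, im_natScale, ModularGroup.im_smul_eq_div_normSq,
    mul_div_assoc', div_div, ← map_mul]
  have hprod : denom γ τ * denom δ (natScale hm (γ • τ)) =
      ((δ 1 0 * m * γ 0 0 + δ 1 1 * γ 1 0 : ℤ) : ℂ) * τ +
        ((δ 1 0 * m * γ 0 1 + δ 1 1 * γ 1 1 : ℤ) : ℂ) := by
    have h1 : ((natScale hm (γ • τ) : ℍ) : ℂ) = m * ((γ 0 0 * τ + γ 0 1) / denom γ τ) := by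
      change (m : ℂ) * ((γ • τ : ℍ) : ℂ) = _
      rw [coe_SL_smul, ModularGroup.denom_apply]
    rw [ModularGroup.denom_apply δ, h1]
    field_simp
    rw [ModularGroup.denom_apply]
    push_cast
    ring
  have hdet := det_SL_eq_one γ
  have hdet' := det_SL_eq_one δ
  have hne : δ 1 0 * m * γ 0 0 + δ 1 1 * γ 1 0 ≠ 0 ∨ δ 1 0 * m * γ 0 1 + δ 1 1 * γ 1 1 ≠ 0 := by
    by_contra! hzero
    obtain ⟨h1, h2⟩ := hzero
    have h3 : δ 1 0 * m = 0 := by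
      linear_combination γ 1 1 * h1 - γ 1 0 * h2 - δ 1 0 * m * hdet
    have h4 : δ 1 1 = 0 := by
      linear_combination γ 0 0 * h2 - γ 0 1 * h1 - δ 1 1 * hdet
    have h5 : δ 1 0 = 0 := (mul_eq_zero.mp h3).resolve_right (by exact_mod_cast hm.ne')
    rw [h4, h5] at hdet'
    simp at hdet'
  rw [hprod]
  have hm0 : (0 : ℝ) ≤ m * τ.im := mul_nonneg (Nat.cast_nonneg m) τ.im_pos.le
  exact div_le_self hm0 (one_le_normSq_intCast_mul_add hτ hne)

/-- The whole `SL(2, ℤ)`-orbit of `m · γτ` has height at most `m · im τ`, so `thetaSize` is at most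
a constant times `(m · im τ)^{1/4}`. Dividing by the height factor of the point itself leaves
`|denom|^{1/2}`. -/
theorem exists_norm_thetaTwo_smul_le : ∃ C : ℝ, 0 ≤ C ∧ ∀ {m : ℕ} (_ : 0 < m) (γ : SL(2, ℤ)) (τ : ℍ),
    1 ≤ τ.im → ‖thetaTwo (m * ↑(γ • τ))‖ ≤ C * ‖denom γ τ‖ ^ (1 / 2 : ℝ) := by
  obtain ⟨C, hC0, hC⟩ := exists_thetaSize_le_of_im_le
  refine ⟨C, hC0, fun {m} hm γ τ hτ ↦ ?_⟩
  have h1 := hC (natScale hm (γ • τ)) (m * τ.im) fun δ ↦ im_SL_smul_natScale_le hm γ δ hτ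
  have hd : 0 < ‖denom γ τ‖ := norm_pos_iff.mpr (denom_ne_zero γ τ)
  have hy : 0 < m * τ.im := mul_pos (Nat.cast_pos.mpr hm) τ.im_pos
  have him : (natScale hm (γ • τ)).im = m * τ.im / ‖denom γ τ‖ ^ 2 := by
    rw [im_natScale, ModularGroup.im_smul_eq_div_normSq, Complex.normSq_eq_norm_sq, mul_div_assoc']
  have hpow : (m * τ.im / ‖denom γ τ‖ ^ 2) ^ (1 / 4 : ℝ) * ‖denom γ τ‖ ^ (1 / 2 : ℝ) =
      (m * τ.im) ^ (1 / 4 : ℝ) := by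
    have hne := (Real.rpow_pos_of_pos hd (1 / 2 : ℝ)).ne'
    rw [Real.div_rpow hy.le (by positivity), ← Real.rpow_natCast, ← Real.rpow_mul hd.le,
      show ((2 : ℕ) : ℝ) * (1 / 4) = 1 / 2 by norm_num, div_mul_cancel₀ _ hne]
  have hpos : 0 < (m * τ.im / ‖denom γ τ‖ ^ 2) ^ (1 / 4 : ℝ) := by positivity
  have h2 : (m * τ.im / ‖denom γ τ‖ ^ 2) ^ (1 / 4 : ℝ) * ‖thetaTwo (m * ↑(γ • τ))‖ ≤
      thetaSize (natScale hm (γ • τ)) := by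
    rw [thetaSize, him]
    refine mul_le_mul_of_nonneg_left ?_ hpos.le
    change _ ≤ ‖thetaTwo (m * ↑(γ • τ))‖ + _ + _
    have := norm_nonneg (jacobiTheta (natScale hm (γ • τ)))
    have := norm_nonneg (thetaFour (natScale hm (γ • τ)))
    linarith
  refine le_of_mul_le_mul_left ((h2.trans h1).trans_eq ?_) hpos
  rw [← hpow]
  ring

theorem isBoundedAtImInfty_thetaTwoProd_slash (hk : Even k) (hc : ∀ i, 0 < c i) (γ : SL(2, ℤ)) :
    IsBoundedAtImInfty (thetaTwoProd c ∣[((k / 2 : ℕ) : ℤ)] γ) := by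
  obtain ⟨C, hC0, hC⟩ := exists_norm_thetaTwo_smul_le
  rw [isBoundedAtImInfty_iff]
  refine ⟨C ^ k, 1, fun τ hτ ↦ ?_⟩
  have hd : 0 < ‖denom γ τ‖ := norm_pos_iff.mpr (denom_ne_zero γ τ)
  have hprod : ‖thetaTwoProd c (γ • τ)‖ ≤ C ^ k * ‖denom γ τ‖ ^ (k / 2) := by
    rw [thetaTwoProd, norm_prod]
    refine (Finset.prod_le_prod (fun i _ ↦ norm_nonneg _) fun i _ ↦ hC (hc i) γ τ hτ).trans_eq ?_
    rw [Finset.prod_const, Finset.card_univ, Fintype.card_fin, mul_pow]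
    congr 1
    obtain ⟨l, rfl⟩ := hk
    rw [show (l + l) / 2 = l by omega, ← Real.rpow_natCast, ← Real.rpow_mul hd.le,
      ← Real.rpow_natCast]
    congr 1
    push_cast
    ring
  rw [ModularForm.SL_slash_apply, norm_mul, norm_zpow, zpow_neg, zpow_natCast, ← div_eq_mul_inv,
    div_le_iff₀ (by positivity)]
  exact hprod

/-- The product `∏ i, θ₂(c_i τ)` as a modular form on `Γ₁(N)`. -/
noncomputable def thetaTwoProdForm (hk : Even k) (hc : ∀ i, 0 < c i)
    (h : (∑ i, c i) ≡ 0 [MOD 8]) :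
    ModularForm ((CongruenceSubgroup.Gamma1 (2 * Finset.univ.lcm c)).map
      (Matrix.SpecialLinearGroup.mapGL ℝ)) ((k / 2 : ℕ) : ℤ) where
  toFun := thetaTwoProd c
  slash_action_eq' := by
    rintro _ ⟨γ, hγ, rfl⟩
    obtain ⟨χ, hχ⟩ := exists_kroneckerSym_character c hk hc h
    have hs := thetaTwoProd_slash_Gamma0 c hk hc h hχ (CongruenceSubgroup.Gamma1_in_Gamma0 _ hγ)
    rw [((CongruenceSubgroup.Gamma1_mem _ γ).mp hγ).2.1, map_one, one_smul] at hs
    exact hs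
  holo' := mdifferentiable_thetaTwoProd c hc
  bdd_at_cusps' := by
    intro x hx
    -- Every cusp is a cusp of the full modular group, so boundedness of all `SL(2, ℤ)`-translates
    -- at infinity suffices.
    have hx' : IsCusp x 𝒮ℒ := hx.mono (by
      rintro _ ⟨γ, -, rfl⟩
      exact ⟨γ, rfl⟩)
    rw [OnePoint.isBoundedAt_iff_forall_SL2Z hx']
    exact fun γ _ ↦ isBoundedAtImInfty_thetaTwoProd_slash c hk hc γ

/-- On the imaginary axis `q` is a positive real, so the series is a sum of positive terms. -/
theorem triangularPsi_I_mul_ne_zero {y : ℝ} (hy : 0 < y) : triangularPsi (y * I) ≠ 0 := by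
  set x : ℝ := Real.exp (-(2 * Real.pi * y)) with hx
  have hx0 : 0 < x := Real.exp_pos _
  have hx1 : x < 1 := by
    rw [hx, Real.exp_lt_one_iff]
    have := Real.pi_pos
    have : 0 < 2 * Real.pi * y := by positivity
    linarith
  have hxc : cexp (2 * Real.pi * I * (y * I)) = (x : ℂ) := by
    rw [hx, Complex.ofReal_exp]
    congr 1
    push_cast
    linear_combination (2 * Real.pi * y) * Complex.I_sq
  have hsum : Summable fun n : ℕ ↦ x ^ (n * (n + 1) / 2) := by
    refine Summable.of_nonneg_of_le (fun n ↦ by positivity) (fun n ↦ ?_)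
      (summable_geometric_of_lt_one hx0.le hx1)
    refine pow_le_pow_of_le_one hx0.le hx1.le ?_
    rw [Nat.le_div_iff_mul_le two_pos]
    rcases Nat.eq_zero_or_pos n with rfl | hn
    · simp
    · exact Nat.mul_le_mul_left n (by omega)
  have hpos : 0 < ∑' n : ℕ, x ^ (n * (n + 1) / 2) :=
    hsum.tsum_pos (fun n ↦ by positivity) 0 (by simp)
  rw [triangularPsi, hxc]
  have : ∑' n : ℕ, (x : ℂ) ^ (n * (n + 1) / 2) = ((∑' n : ℕ, x ^ (n * (n + 1) / 2) : ℝ) : ℂ) := by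
    push_cast
    rfl
  rw [this]
  exact_mod_cast hpos.ne'

theorem thetaTwoProd_I_ne_zero (hc : ∀ i, 0 < c i) : thetaTwoProd c UpperHalfPlane.I ≠ 0 := by
  have h := exp_mul_triangularPsiProd c hc UpperHalfPlane.I
  intro h0
  rw [h0, mul_zero, mul_eq_zero, triangularPsiProd, Finset.prod_eq_zero_iff] at h
  rcases h with h | ⟨i, -, hi⟩
  · exact Complex.exp_ne_zero _ h
  · refine triangularPsi_I_mul_ne_zero (y := c i) (Nat.cast_pos.mpr (hc i)) ?_
    rw [Complex.ofReal_natCast]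
    exact hi

theorem sum_modEq_zero_of_T_invariant (hc : ∀ i, 0 < c i)
    (hT : thetaTwoProd c (ModularGroup.T • UpperHalfPlane.I) = thetaTwoProd c UpperHalfPlane.I) :
    (∑ i, c i) ≡ 0 [MOD 8] := by
  rw [thetaTwoProd_T_smul] at hT
  have hexp := mul_right_cancel₀ (thetaTwoProd_I_ne_zero c hc) (hT.trans (one_mul _).symm)
  obtain ⟨n, hn⟩ := Complex.exp_eq_one_iff.mp hexp
  have h8 : ((∑ i, c i : ℕ) : ℂ) = 8 * n := by
    have h2 : (2 * Real.pi * I : ℂ) ≠ 0 := Complex.two_pi_I_ne_zero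
    have h3 : ((∑ i, c i : ℕ) / 8 : ℂ) = n := mul_left_cancel₀ h2 (hn.trans (mul_comm _ _))
    rw [← h3]
    ring
  rw [Nat.modEq_zero_iff_dvd, ← Int.natCast_dvd_natCast]
  exact ⟨n, by exact_mod_cast h8⟩

end ThetaProduct

theorem theorem1p1 (k : ℕ) (hk : 2 ≤ k) (hk_even : Even k)
    (c : Fin k → ℕ) (hc : ∀ i, 0 < c i) :
    (∃ χ : DirichletCharacter ℂ (2 * Finset.univ.lcm c),
      (∀ d : ℤ, χ (d : ZMod (2 * Finset.univ.lcm c)) =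
        (kroneckerSym ((-1) ^ (k / 2) * 4 * ∏ i, (c i : ℤ)) d : ℂ)) ∧
      ∃ f ∈ modularFormsWithChar (2 * Finset.univ.lcm c) ((k / 2 : ℕ) : ℤ) χ,
        ∀ τ : UpperHalfPlane,
          f τ = Complex.exp (2 * Real.pi * Complex.I * (τ : ℂ) * ((∑ i, c i : ℕ) / 8 : ℂ))
            * triangularPsiProd c (τ : ℂ)) ↔
    (∑ i, c i) ≡ 0 [MOD 8] := by
  constructor
  · rintro ⟨χ, -, f, hf, hfτ⟩
    have hT := congrFun (hf ModularGroup.T (by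
      rw [CongruenceSubgroup.Gamma0_mem]
      simp [ModularGroup.T])) UpperHalfPlane.I
    rw [show ModularGroup.T 1 1 = 1 from rfl, Int.cast_one, map_one, one_smul,
      ModularForm.SL_slash_apply, denom_T, one_zpow, mul_one, hfτ, hfτ,
      exp_mul_triangularPsiProd c hc, exp_mul_triangularPsiProd c hc] at hT
    exact sum_modEq_zero_of_T_invariant c hc (mul_left_cancel₀ (by simp) hT)
  · intro h
    obtain ⟨χ, hχ⟩ := exists_kroneckerSym_character c hk_even hc h
    refine ⟨χ, hχ, ((1 / 2 : ℂ) ^ k) • thetaTwoProdForm c hk_even hc h,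
      Submodule.smul_mem _ _ fun γ hγ ↦ thetaTwoProd_slash_Gamma0 c hk_even hc h hχ hγ, fun τ ↦ ?_⟩
    rw [exp_mul_triangularPsiProd c hc]
    rfl
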